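/- Let $d\ge 2$ and write $\mathbb R^{2d-1}=\mathbb R^{d-1}\times\mathbb R\times\mathbb R^{d-1}$ with coordinates $(z_0,z_1,z_2)$ and the Euclidean metric. Fix $z_2^*\in\mathbb R^{d-1}\setminus\{0\}$ and let $$K_0=\{(z_0,z_1,0): |z_0|^2+z_1^2=1\},\quad K_1=\{(0,z_1+1,z_2): z_1^2+|z_2|^2=1\},\quad K_2=\{(z_0,z_1,z_2^*): |z_0|^2+z_1^2=1\},$$ so that $K_0\cup K_1$ is a higher-dimensional Hopf link and $K_0\cup K_2$ an unlink of two $(d-1)$-spheres. Identify $T^*\mathbb R^{2d-1}$ with $\mathbb R^{2d-1}\times\mathbb R^{2d-1}$ by the metric, and let $UT^*\mathbb R^{2d-1}=\{(q,p): |p|=1\}$. For a submanifold $K\subset\mathbb R^{2d-1}$ let $L_K=\{(q,p): q\in K,\ p\perp T_qK\}$ be its conormal bundle and $\Lambda_K=L_K\cap UT^*\mathbb R^{2d-1}$ its unit conormal bundle. A spin structure on a manifold of dimension at least $2$ means an orientation together with a double covering of the bundle of positively oriented tangent frames which is non-trivial over each fibre. Fix a spin structure on $\mathbb R^{2d-1}$.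 It induces a spin structure on $\Lambda_K$ as follows: the isomorphisms $T_{(q,p)}L_K\to T_qK\oplus (T_qK)^\perp=T_q\mathbb R^{2d-1}$, $(v,w)\mapsto v+\mathrm{pr}_{(T_qK)^\perp}w$, which for $p=0$ are the canonical identification along the zero section, pull it back to a spin structure on $TL_K$; and $\Lambda_K$ carries the spin structure whose stabilization is the restriction of the latter to $TL_K|_{\Lambda_K}=\underline{\mathbb R}\oplus T\Lambda_K$, where $\underline{\mathbb R}$ is spanned by the radial vector $(0,p)$, placed first. Then $\Lambda_{K_0\cup K_1}$ and $\Lambda_{K_0\cup K_2}$ are smooth $(2d-2)$-dimensional submanifolds, the structures just described are spin structures on them, and with these spin structures they are isotopic as smooth submanifolds of $UT^*\mathbb R^{2d-1}$: there is a smooth family of embeddings $F_s\colon\Lambda_{K_0\cup K_1}\to UT^*\mathbb R^{2d-1}$, $s\in[0,1]$, such that $F_0$ is the inclusion and $F_1$ is a diffeomorphism onto $\Lambda_{K_0\cup K_2}$ whose differential lifts to an isomorphism of the two spin structures. -/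

import Mathlib

open Set
open scoped ContDiff InnerProductSpace

namespace ConormalSpin

section Submanifolds

variable {V W : Type} [NormedAddCommGroup V] [NormedSpace ℝ V]
  [NormedAddCommGroup W] [NormedSpace ℝ W]

/-- The tangent space of `S ⊆ V` at `x`. For an embedded smooth submanifold the tangent cone is
already a linear subspace, the usual tangent space, and the span adds nothing. -/
def tangentSpace (S : Set V) (x : V) : Submodule ℝ V :=
  Submodule.span ℝ (tangentConeAt ℝ S x)

/-- `f` restricts to a smooth embedding of `S`: it is smooth on `S` and has a smooth inverse
`f(S) → S`. (For a submanifold `S`, differentiating `g ∘ f = id` shows that this is an immersion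
which is a homeomorphism onto its image, and conversely.) -/
def IsSmoothEmbeddingOn (f : V → W) (S : Set V) : Prop :=
  ContDiffOn ℝ ∞ f S ∧ ∃ g : W → V, ContDiffOn ℝ ∞ g (f '' S) ∧ LeftInvOn g f S

/-- `S` is an embedded smooth `k`-dimensional submanifold of `V`: every point of `S` has a
neighbourhood in `S` that is diffeomorphic to an open subset of `ℝ^k`. -/
def IsSmoothSubmanifold (k : ℕ) (S : Set V) : Prop :=
  ∀ x ∈ S, ∃ U : Set V, IsOpen U ∧ x ∈ U ∧
    ∃ O : Set (EuclideanSpace ℝ (Fin k)), IsOpen O ∧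
      ∃ φ : EuclideanSpace ℝ (Fin k) → V, IsSmoothEmbeddingOn φ O ∧ φ '' O = S ∩ U

/-- The total space of the bundle of linear frames of the tangent bundle of a `k`-dimensional
submanifold `S`, as a subspace of `V × V^k`. -/
def frameBundle (S : Set V) (k : ℕ) : Set (V × (Fin k → V)) :=
  {a | a.1 ∈ S ∧ LinearIndependent ℝ a.2 ∧ Submodule.span ℝ (range a.2) = tangentSpace S a.1}

/-- The rotation by the angle `θ` of the `i`-th and `j`-th vectors of the frame `f`. -/
noncomputable def rotateFrame {k : ℕ} (i j : Fin k) (θ : ℝ) (f : Fin k → V) : Fin k → V :=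
  Function.update (Function.update f i (Real.cos θ • f i + Real.sin θ • f j))
    j (-Real.sin θ • f i + Real.cos θ • f j)

end Submanifolds

universe u

/-- A topological space with a map to the space of `k`-frames in `V`. -/
structure FrameCover (V : Type) (k : ℕ) where
  /-- the total space -/
  carrier : Type u
  /-- its topology -/
  [top : TopologicalSpace carrier]
  /-- the projection -/
  proj : carrier → V × (Fin k → V)

attribute [instance] FrameCover.top

section Spin

variable {V W : Type} [NormedAddCommGroup V] [NormedSpace ℝ V]
  [NormedAddCommGroup W] [NormedSpace ℝ W]

/-- The pullback (fibre product) of `σ` along a map `φ` of frames defined on `A`. -/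
def FrameCover.pullback {k l : ℕ} (σ : FrameCover.{u} V k) (A : Set (W × (Fin l → W)))
    (φ : W × (Fin l → W) → V × (Fin k → V)) : FrameCover.{u} W l where
  carrier := {y : σ.carrier × (W × (Fin l → W)) // y.2 ∈ A ∧ σ.proj y.1 = φ y.2}
  proj := fun y => y.1.2

/-- Spin structures on (the tangent bundle of) a `k`-dimensional submanifold `S`, `k ≥ 2`:
an orientation of `S` together with a double covering of the bundle of positive frames whose
restriction to each fibre is non-trivial. The positive frames are the image of the projection.
The fibre of the bundle of positive frames is a copy of `GL⁺(k)`, whose fundamental group is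
generated by the loop that rotates two of the frame vectors once; hence the covering is
non-trivial on the fibre if and only if this loop does not lift to a closed loop. -/
structure IsSpinStructure {k : ℕ} (S : Set V) (σ : FrameCover.{u} V k) : Prop where
  proj_mem : ∀ y, σ.proj y ∈ frameBundle S k
  /-- over each point of `S`, the image is exactly one of the two orientation classes -/
  orientation : ∀ (x : V) (f : Fin k → V) (g : Matrix (Fin k) (Fin k) ℝ),
    (x, f) ∈ frameBundle S k → g.det ≠ 0 →
      ((x, fun j => ∑ i, g i j • f i) ∈ range σ.proj ↔ ((x, f) ∈ range σ.proj ↔ 0 < g.det))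
  /-- the orientation varies continuously -/
  isOpen_positive : IsOpen {a : frameBundle S k | (a : V × (Fin k → V)) ∈ range σ.proj}
  isCoveringMap : IsCoveringMap (rangeFactorization σ.proj)
  two_sheeted : ∀ a ∈ range σ.proj, (σ.proj ⁻¹' {a}).ncard = 2
  nontrivial_on_fibres : ∀ (i j : Fin k), i ≠ j → ∀ γ : C(unitInterval, σ.carrier),
    (∀ t : unitInterval, σ.proj (γ t) =
      ((σ.proj (γ 0)).1, rotateFrame i j (2 * Real.pi * t) (σ.proj (γ 0)).2)) →
    γ 1 ≠ γ 0

/-- `S₀` and `S₁`, with the spin structures `σ₀` and `σ₁`, are isotopic as smooth submanifolds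
of `N ⊆ V` with spin structures: there is a smooth family of embeddings `F s : S₀ → N`,
`s ∈ [0,1]`, from the inclusion to a diffeomorphism `S₀ → S₁` whose differential on frames is
covered by an isomorphism of `σ₀` with `σ₁` (that is, transporting `σ₀` along the isotopy
gives `σ₁`). On vectors tangent to `S₀`, `fderivWithin ℝ (F 1) S₀ x` is the differential
of the map `F 1` of the submanifold `S₀`. -/
def SpinIsotopic {k : ℕ} (N S₀ S₁ : Set V) (σ₀ σ₁ : FrameCover.{u} V k) : Prop :=
  ∃ F : ℝ → V → V,
    ContDiffOn ℝ ∞ (Function.uncurry F) (Icc (0 : ℝ) 1 ×ˢ S₀) ∧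
    (∀ s ∈ Icc (0 : ℝ) 1, IsSmoothEmbeddingOn (F s) S₀ ∧ MapsTo (F s) S₀ N) ∧
    (∀ x ∈ S₀, F 0 x = x) ∧
    F 1 '' S₀ = S₁ ∧
    ∃ Φ : σ₀.carrier ≃ₜ σ₁.carrier, ∀ y,
      σ₁.proj (Φ y) = (F 1 (σ₀.proj y).1,
        fun i => fderivWithin ℝ (F 1) S₀ (σ₀.proj y).1 ((σ₀.proj y).2 i))

end Spin

section Conormal

variable {V : Type} [NormedAddCommGroup V] [InnerProductSpace ℝ V] [FiniteDimensional ℝ V]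

/-- The unit cotangent bundle of the Euclidean space `V`, with `T^*V` identified with
`TV = V × V` by the metric. -/
def unitCotangent (V : Type) [NormedAddCommGroup V] : Set (V × V) := {x | ‖x.2‖ = 1}

/-- The conormal bundle `L_K`. -/
def conormal (K : Set V) : Set (V × V) :=
  {x | x.1 ∈ K ∧ ∀ v ∈ tangentSpace K x.1, ⟪x.2, v⟫_ℝ = 0}

/-- The unit conormal bundle `Λ_K`. -/
def unitConormal (K : Set V) : Set (V × V) := conormal K ∩ unitCotangent V

/-- At a point `x = (q, p)` of `L_K`, the isomorphism of `T_x L_K` with `T_q V = V` that maps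
`(v, w)` to the sum of `v` (in `T_q K`) and the component of `w` in `(T_q K)^⊥`. For `p = 0` it is
the identification `T_(q,0) L_K = T_q K ⊕ (T_q K)^⊥ = T_q V`. -/
noncomputable def conormalIso (K : Set V) (x : V × V) : V × V →ₗ[ℝ] V :=
  LinearMap.fst ℝ V V +
    (((tangentSpace K x.1)ᗮ).starProjection : V →ₗ[ℝ] V) ∘ₗ LinearMap.snd ℝ V V

/-- The spin structure on `T L_K` that extends the one on `T L_K|_K ≅ TV|_K` induced by the spin
structure `σ` on `V`: the pullback of `σ` by the bundle isomorphisms `conormalIso`. -/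
noncomputable def conormalCover {k : ℕ} (σ : FrameCover.{u} V k) (K : Set V) :
    FrameCover.{u} (V × V) k :=
  σ.pullback (frameBundle (conormal K) k) fun a => (a.1.1, fun i => conormalIso K a.1 (a.2 i))

/-- The spin structure on `Λ_K`: along `Λ_K` one has `T L_K = ℝ ⊕ T Λ_K`, where the line is
spanned by the radial vector `(0, p)` at `(q, p)`, and the spin structure on `T Λ_K` is the one
whose stabilization is the spin structure on `T L_K`; so its positive frames and their
lifts are those of the stabilized frames. -/
noncomputable def unitConormalCover {k : ℕ} (σ : FrameCover.{u} V (k + 1)) (K : Set V) :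
    FrameCover.{u} (V × V) k :=
  (conormalCover σ K).pullback (frameBundle (unitConormal K) k)
    fun a => (a.1, Fin.cons (0, a.1.2) a.2)

end Conormal

section Spheres

/-- `ℝ^(2d-1) = ℝ^(d-1) × ℝ × ℝ^(d-1)` with the Euclidean metric. -/
abbrev Space (d : ℕ) : Type := EuclideanSpace ℝ (Fin (d - 1) ⊕ Unit ⊕ Fin (d - 1))

/-- The point `(z₀, z₁, z₂)`. -/
def point {d : ℕ} (z₀ : EuclideanSpace ℝ (Fin (d - 1))) (z₁ : ℝ)
    (z₂ : EuclideanSpace ℝ (Fin (d - 1))) : Space d :=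
  WithLp.toLp 2 (Sum.elim z₀ (Sum.elim (fun _ => z₁) z₂))

/-- `K₀ = {(z₀, z₁, 0) : |z₀|² + z₁² = 1}`. -/
def K₀ (d : ℕ) : Set (Space d) :=
  {x | ∃ (z₀ : EuclideanSpace ℝ (Fin (d - 1))) (z₁ : ℝ),
    ‖z₀‖ ^ 2 + z₁ ^ 2 = 1 ∧ x = point z₀ z₁ 0}

/-- `K₁ = {(0, z₁ + 1, z₂) : z₁² + |z₂|² = 1}`. -/
def K₁ (d : ℕ) : Set (Space d) :=
  {x | ∃ (z₁ : ℝ) (z₂ : EuclideanSpace ℝ (Fin (d - 1))),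
    z₁ ^ 2 + ‖z₂‖ ^ 2 = 1 ∧ x = point 0 (z₁ + 1) z₂}

/-- `K₂ = {(z₀, z₁, z) : |z₀|² + z₁² = 1}` for a fixed vector `z`. -/
def K₂ (d : ℕ) (z : EuclideanSpace ℝ (Fin (d - 1))) : Set (Space d) :=
  {x | ∃ (z₀ : EuclideanSpace ℝ (Fin (d - 1))) (z₁ : ℝ),
    ‖z₀‖ ^ 2 + z₁ ^ 2 = 1 ∧ x = point z₀ z₁ z}

end Spheres

end ConormalSpin

open ConormalSpin

universe u

/-! Only the conormal of `K₁` moves; that of `K₀` stays fixed. In the base the two spheres must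
cross, but an isotopy in the unit cotangent bundle only has to keep the covectors apart over a
crossing. Translating `K₁` along the `z₁`-axis, it meets `K₀` only where `z₀ = 0` and `z₂ = 0`.
There a conormal covector of `K₁` has `p₂ = 0` and one of `K₀` has `p₀ = 0`. So, before any
crossing, the fibres over `K₁` are pushed in the direction of `z` in the `z₂`-factor, which makes
`p₂` nonzero at these points, and are rotated by a right angle in the `(z₀, z₂)`-directions, which
turns `p₂` into `-p₀`. Then `K₁` can be translated through `K₀`. Push and rotation are both needed:
without the push the rotated covector may still have `p₀ = 0`, and without the rotation a nonzero
`p₂` obstructs nothing. Far from `K₀` the base is rotated into position and the push is undone;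
finally it is moved onto `K₂` inside the affine subspace `z₂ = z`, which misses `K₀`. This is
`unlink`, and `motion_notMem_unitConormal_K₀` is the disjointness argument.

At time one the map on the moved component is induced by a rigid motion of the base taking `K₁` to
`K₂`. The induced spin structure on a unit conormal bundle is natural under rigid motions, and a
rigid motion joined to the identity lifts to the given spin structure on Euclidean space
(`IsSpinStructure.exists_rigid_lift`). Combining this lift over `K₁` with the identity over `K₀`
gives the required isomorphism (`exists_homeomorph_moveFrame`, `spinIsotopic_of_motion`). Only the
final differential has to be covered, so the path used for lifting may differ from the isotopy.

The remaining claims are local, and near each point the links are round spheres. There the conormal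
bundle has an explicit equation; differentiating it shows that `conormalIso` is injective on tangent
vectors. Both induced structures are then pullbacks along maps of frame bundles
(`IsSpinStructure.pullback`). -/

namespace ConormalSpin

open Filter Topology

/-! ### Disjoint unions of closed sets -/

section DisjointUnion

variable {V : Type} [TopologicalSpace V] {Q P : Set V}

theorem eventually_mem_union_iff_right (hQ : IsClosed Q) (hd : Disjoint Q P) {q : V}
    (hq : q ∈ P) : ∀ᶠ y in 𝓝 q, y ∈ Q ∪ P ↔ y ∈ P := by
  filter_upwards [hQ.isOpen_compl.mem_nhds (disjoint_right.1 hd hq)] with y hy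
  exact ⟨fun h => h.resolve_left hy, Or.inr⟩

theorem eventually_mem_union_iff_left (hP : IsClosed P) (hd : Disjoint Q P) {q : V}
    (hq : q ∈ Q) : ∀ᶠ y in 𝓝 q, y ∈ Q ∪ P ↔ y ∈ Q := by
  filter_upwards [hP.isOpen_compl.mem_nhds (disjoint_left.1 hd hq)] with y hy
  exact ⟨fun h => h.resolve_right hy, Or.inl⟩

/-- The two closed pieces are disjoint and cover the image of `π`, so the preimage of `P` is clopen
and has empty frontier. -/
theorem continuous_ite_mem {Y Z : Type*} [TopologicalSpace Y] [TopologicalSpace Z]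
    [DecidablePred (· ∈ P)] (hQ : IsClosed Q) (hP : IsClosed P) (hd : Disjoint Q P) {π : Y → V}
    (hπ : Continuous π) (hm : ∀ y, π y ∈ Q ∪ P) {f g : Y → Z} (hf : Continuous f)
    (hg : Continuous g) : Continuous fun y => if π y ∈ P then f y else g y := by
  have hcl : IsClopen (π ⁻¹' P) := by
    refine ⟨hP.preimage hπ, ?_⟩
    have : π ⁻¹' P = (π ⁻¹' Q)ᶜ := by
      ext y
      exact ⟨fun h => disjoint_right.1 hd h, fun h => (hm y).resolve_left h⟩
    rw [this]
    exact (hQ.preimage hπ).isOpen_compl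
  refine hf.if (fun y hy => ?_) hg
  have : frontier (π ⁻¹' P) = ∅ := hcl.frontier_eq
  exact absurd hy (by change y ∉ frontier (π ⁻¹' P); rw [this]; exact notMem_empty y)

end DisjointUnion

/-! ### Tangent spaces of subsets and derivatives within them -/

section TangentSpace

variable {V W : Type} [NormedAddCommGroup V] [NormedSpace ℝ V]
  [NormedAddCommGroup W] [NormedSpace ℝ W] {S T : Set V} {x : V}

theorem tangentSpace_univ (x : V) : tangentSpace (univ : Set V) x = ⊤ := by
  simp [tangentSpace, tangentConeAt_univ]

theorem tangentSpace_mono (h : S ⊆ T) (x : V) : tangentSpace S x ≤ tangentSpace T x :=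
  Submodule.span_mono (tangentConeAt_mono h)

theorem tangentSpace_congr (h : ∀ᶠ y in 𝓝 x, y ∈ S ↔ y ∈ T) :
    tangentSpace S x = tangentSpace T x := by
  have h' : 𝓝[S] x = 𝓝[T] x := nhdsWithin_eq_iff_eventuallyEq.2 (h.mono fun y hy => propext hy)
  rw [tangentSpace, tangentSpace, tangentConeAt_congr h']

/-- A derivative within `S` need not be unique on the ambient space, but it is determined on the
tangent cone and hence on its span. This allows `fderivWithin` to be evaluated on tangent vectors by
means of any convenient derivative. -/
theorem hasFDerivWithinAt_apply_eq {f : V → W} {f' f'' : V →L[ℝ] W}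
    (h' : HasFDerivWithinAt f f' S x) (h'' : HasFDerivWithinAt f f'' S x) {v : V}
    (hv : v ∈ tangentSpace S x) : f' v = f'' v :=
  LinearMap.eqOn_span (f := (f' : V →ₗ[ℝ] W)) (g := (f'' : V →ₗ[ℝ] W)) (h'.unique_on h'') hv

theorem hasFDerivWithinAt_apply_eq_zero {f : V → W} {f' : V →L[ℝ] W} {c : W}
    (h : HasFDerivWithinAt f f' S x) (hx : x ∈ S) (hc : ∀ y ∈ S, f y = c) {v : V}
    (hv : v ∈ tangentSpace S x) : f' v = 0 :=
  hasFDerivWithinAt_apply_eq h ((hasFDerivWithinAt_const c x S).congr hc (hc x hx)) hv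

theorem fderivWithin_apply_eq {f : V → W} {f' : V →L[ℝ] W} (h : HasFDerivWithinAt f f' S x)
    {v : V} (hv : v ∈ tangentSpace S x) : fderivWithin ℝ f S x v = f' v :=
  hasFDerivWithinAt_apply_eq h.differentiableWithinAt.hasFDerivWithinAt h hv

theorem apply_mem_tangentSpace {f : V → W} {f' : V →L[ℝ] W} (h : HasFDerivWithinAt f f' S x)
    {T : Set W} (hf : MapsTo f S T) {v : V} (hv : v ∈ tangentSpace S x) :
    f' v ∈ tangentSpace T (f x) := by
  have h1 : tangentSpace S x ≤ (tangentSpace T (f x)).comap (f' : V →ₗ[ℝ] W) := by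
    refine Submodule.span_le.2 fun w hw => ?_
    exact Submodule.subset_span (tangentConeAt_mono hf.image_subset (h.mapsTo_tangent_cone hw))
  exact h1 hv

theorem deriv_mem_tangentSpace {γ : ℝ → V} {v : V} {t : ℝ} (h : HasDerivAt γ v t)
    (hγ : ∀ s, γ s ∈ S) : v ∈ tangentSpace S (γ t) := by
  have h1 := apply_mem_tangentSpace (S := univ) (T := S) h.hasFDerivAt.hasFDerivWithinAt
    (fun s _ => hγ s) (v := (1 : ℝ)) (by rw [tangentSpace_univ]; trivial)
  simpa using h1

theorem tangentSpace_image_affine (L : V ≃L[ℝ] W) (t : W) (S : Set V) (x : V) :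
    tangentSpace ((fun y => L y + t) '' S) (L x + t) =
      (tangentSpace S x).map (L : V →ₗ[ℝ] W) := by
  apply le_antisymm
  · intro w hw
    have h1 : HasFDerivWithinAt (fun y => L.symm (y - t)) (L.symm : W →L[ℝ] V)
        ((fun y => L y + t) '' S) (L x + t) :=
      ((L.symm : W →L[ℝ] V).hasFDerivAt.comp (L x + t)
        ((hasFDerivAt_id (𝕜 := ℝ) (L x + t)).sub_const t)).hasFDerivWithinAt
    have h2 := apply_mem_tangentSpace h1 (T := S) (by rintro _ ⟨y, hy, rfl⟩; simpa using hy) hw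
    refine ⟨L.symm w, by simpa using h2, by simp⟩
  · rintro _ ⟨v, hv, rfl⟩
    have h1 : HasFDerivWithinAt (fun y => L y + t) (L : V →L[ℝ] W) S x :=
      ((L : V →L[ℝ] W).hasFDerivAt.add_const t).hasFDerivWithinAt
    exact apply_mem_tangentSpace h1 (mapsTo_image _ _) hv

end TangentSpace

/-! ### Locality of the conormal constructions -/

section ConormalLocal

variable {V : Type} [NormedAddCommGroup V] [InnerProductSpace ℝ V]
  {K K' : Set V} {x : V × V}

/-- Membership over a base point depends only on the germ of the submanifold there, and two sets
that agree near `x.1` have the same germ at all nearby points. -/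
theorem eventually_mem_conormal_iff (h : ∀ᶠ q in 𝓝 x.1, q ∈ K ↔ q ∈ K') :
    ∀ᶠ y in 𝓝 x, y ∈ conormal K ↔ y ∈ conormal K' := by
  have h1 : ∀ᶠ y : V × V in 𝓝 x, ∀ᶠ q in 𝓝 y.1, q ∈ K ↔ q ∈ K' :=
    continuous_fst.continuousAt.eventually h.eventually_nhds
  filter_upwards [h1] with y hy
  rw [conormal, conormal, mem_ofPred_eq, mem_ofPred_eq, hy.self_of_nhds, tangentSpace_congr hy]

theorem eventually_mem_unitConormal_iff (h : ∀ᶠ q in 𝓝 x.1, q ∈ K ↔ q ∈ K') :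
    ∀ᶠ y in 𝓝 x, y ∈ unitConormal K ↔ y ∈ unitConormal K' := by
  filter_upwards [eventually_mem_conormal_iff h] with y hy
  rw [unitConormal, unitConormal, mem_inter_iff, mem_inter_iff, hy]

theorem conormalIso_congr [FiniteDimensional ℝ V] (h : ∀ᶠ q in 𝓝 x.1, q ∈ K ↔ q ∈ K') :
    conormalIso K x = conormalIso K' x := by
  simp only [conormalIso, tangentSpace_congr h]

end ConormalLocal

/-! ### Naturality under rigid motions -/

section RigidMotion

variable {V : Type} [NormedAddCommGroup V] [InnerProductSpace ℝ V]

/-- The rigid motion `q ↦ A q + t` of `V`. -/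
def rigid (A : V ≃ₗᵢ[ℝ] V) (t : V) (q : V) : V := A q + t

/-- The action of a rigid motion on `T^*V = V × V`. -/
def cotangentRigid (A : V ≃ₗᵢ[ℝ] V) (t : V) (x : V × V) : V × V := (A x.1 + t, A x.2)

/-- The differential of `cotangentRigid`. -/
def cotangentLin (A : V ≃ₗᵢ[ℝ] V) : (V × V) ≃L[ℝ] (V × V) :=
  A.toContinuousLinearEquiv.prodCongr A.toContinuousLinearEquiv

@[simp] theorem cotangentLin_apply (A : V ≃ₗᵢ[ℝ] V) (x : V × V) :
    cotangentLin A x = (A x.1, A x.2) := rfl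

theorem cotangentRigid_eq (A : V ≃ₗᵢ[ℝ] V) (t : V) :
    cotangentRigid A t = fun x => cotangentLin A x + (t, 0) := by
  ext x <;> simp [cotangentRigid]

theorem tangentSpace_rigid (A : V ≃ₗᵢ[ℝ] V) (t : V) (K : Set V) (q : V) :
    tangentSpace (rigid A t '' K) (A q + t) =
      (tangentSpace K q).map (A.toLinearEquiv : V →ₗ[ℝ] V) :=
  tangentSpace_image_affine A.toContinuousLinearEquiv t K q

theorem tangentSpace_cotangentRigid (A : V ≃ₗᵢ[ℝ] V) (t : V) (S : Set (V × V)) (x : V × V) :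
    tangentSpace (cotangentRigid A t '' S) (cotangentRigid A t x) =
      (tangentSpace S x).map (cotangentLin A : V × V →ₗ[ℝ] V × V) := by
  simp only [cotangentRigid_eq]
  exact tangentSpace_image_affine (cotangentLin A) (t, 0) S x

theorem cotangentRigid_symm (A : V ≃ₗᵢ[ℝ] V) (t : V) (x : V × V) :
    cotangentRigid A t (cotangentRigid A.symm (-A.symm t) x) = x := by
  simp [cotangentRigid]

theorem cotangentRigid_mem_conormal_iff (A : V ≃ₗᵢ[ℝ] V) (t : V) (K : Set V) (x : V × V) :
    cotangentRigid A t x ∈ conormal (rigid A t '' K) ↔ x ∈ conormal K := by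
  have h1 : A x.1 + t ∈ rigid A t '' K ↔ x.1 ∈ K :=
    ⟨by rintro ⟨y, hy, h⟩; simp only [rigid, add_left_inj, A.injective.eq_iff] at h; rwa [← h],
      fun h => ⟨x.1, h, rfl⟩⟩
  simp only [conormal, mem_ofPred_eq, cotangentRigid, h1, tangentSpace_rigid]
  refine and_congr_right fun _ => ⟨fun h v hv => ?_, ?_⟩
  · rw [← A.inner_map_map]; exact h _ ⟨v, hv, rfl⟩
  · rintro h _ ⟨v, hv, rfl⟩
    simpa using h v hv

theorem cotangentRigid_mem_unitConormal_iff (A : V ≃ₗᵢ[ℝ] V) (t : V) (K : Set V) (x : V × V) :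
    cotangentRigid A t x ∈ unitConormal (rigid A t '' K) ↔ x ∈ unitConormal K := by
  rw [unitConormal, unitConormal, mem_inter_iff, cotangentRigid_mem_conormal_iff]
  simp [cotangentRigid, unitCotangent]

theorem conormal_rigid (A : V ≃ₗᵢ[ℝ] V) (t : V) (K : Set V) :
    conormal (rigid A t '' K) = cotangentRigid A t '' conormal K := by
  ext y
  refine ⟨fun h => ⟨_, ?_, cotangentRigid_symm A t y⟩, ?_⟩
  · rwa [← cotangentRigid_mem_conormal_iff A t, cotangentRigid_symm]
  · rintro ⟨x, hx, rfl⟩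
    rwa [cotangentRigid_mem_conormal_iff]

theorem unitConormal_rigid (A : V ≃ₗᵢ[ℝ] V) (t : V) (K : Set V) :
    unitConormal (rigid A t '' K) = cotangentRigid A t '' unitConormal K := by
  ext y
  refine ⟨fun h => ⟨_, ?_, cotangentRigid_symm A t y⟩, ?_⟩
  · rwa [← cotangentRigid_mem_unitConormal_iff A t, cotangentRigid_symm]
  · rintro ⟨x, hx, rfl⟩
    rwa [cotangentRigid_mem_unitConormal_iff]

/-- An isometry conjugates the orthogonal projection onto a subspace to the projection onto its
image. -/
theorem conormalIso_rigid [FiniteDimensional ℝ V] (A : V ≃ₗᵢ[ℝ] V) (t : V) (K : Set V)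
    (x w : V × V) : conormalIso (rigid A t '' K) (cotangentRigid A t x) (cotangentLin A w) =
      A (conormalIso K x w) := by
  simp only [conormalIso, LinearMap.add_apply, LinearMap.fst_apply, LinearMap.comp_apply,
    LinearMap.snd_apply, cotangentLin_apply, map_add, cotangentRigid,
    Submodule.starProjection_orthogonal_val, ContinuousLinearMap.coe_coe]
  rw [tangentSpace_rigid]
  have h := Submodule.starProjection_map_apply A (tangentSpace K x.1) (A w.2)
  simp only [LinearIsometryEquiv.symm_apply_apply] at h
  rw [map_sub, ← h]

end RigidMotion

/-! ### The conormal bundle of a round sphere -/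

section RoundSphere

variable {V : Type} [NormedAddCommGroup V] [InnerProductSpace ℝ V] [FiniteDimensional ℝ V]

/-- The unit sphere around `c` in the affine subspace `c + E`. -/
def roundSphere (c : V) (E : Submodule ℝ V) : Set V := {q | q - c ∈ E ∧ ‖q - c‖ = 1}

variable {c q : V} {E : Submodule ℝ V}

/-- One inclusion differentiates the equations of the sphere: the component of `q - c` orthogonal to
`E` vanishes and its norm is one. For the other, a unit vector satisfying the linear conditions is
the velocity of a great circle. -/
theorem mem_tangentSpace_roundSphere (hq : q ∈ roundSphere c E) {v : V} :
    v ∈ tangentSpace (roundSphere c E) q ↔ v ∈ E ∧ ⟪q - c, v⟫_ℝ = 0 := by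
  constructor
  · intro hv
    constructor
    · have h1 : HasFDerivWithinAt (fun y => Eᗮ.starProjection (y - c)) (Eᗮ.starProjection)
          (roundSphere c E) q :=
        (Eᗮ.starProjection.hasFDerivAt.comp q
          ((hasFDerivAt_id (𝕜 := ℝ) q).sub_const c)).hasFDerivWithinAt
      have h2 := hasFDerivWithinAt_apply_eq_zero h1 hq (c := 0)
        (fun y hy => by
          rw [Submodule.starProjection_apply_eq_zero_iff, Submodule.orthogonal_orthogonal]
          exact hy.1) hv
      rwa [Submodule.starProjection_apply_eq_zero_iff, Submodule.orthogonal_orthogonal] at h2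
    · have h1 := ((hasFDerivAt_id (𝕜 := ℝ) q).sub_const c).norm_sq.hasFDerivWithinAt
        (s := roundSphere c E)
      have h2 := hasFDerivWithinAt_apply_eq_zero h1 hq (c := 1)
        (fun y hy => by simp [hy.2]) hv
      simpa [← inner_sub_left] using h2
  · rintro ⟨hv, hv'⟩
    have key : ∀ w ∈ E, ⟪q - c, w⟫_ℝ = 0 → ‖w‖ = 1 → w ∈ tangentSpace (roundSphere c E) q := by
      intro w hw hw' hw1
      have h1 : HasDerivAt (fun t : ℝ => c + (Real.cos t • (q - c) + Real.sin t • w)) w 0 := by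
        have h2 := ((Real.hasDerivAt_cos 0).smul_const (q - c)).add
          ((Real.hasDerivAt_sin 0).smul_const w)
        simpa using h2.const_add c
      have h3 := deriv_mem_tangentSpace (S := roundSphere c E) h1 (fun s => by
        refine ⟨by simpa using E.add_mem (E.smul_mem _ hq.1) (E.smul_mem _ hw), ?_⟩
        have h4 : ‖Real.cos s • (q - c) + Real.sin s • w‖ ^ 2 = 1 := by
          rw [norm_add_sq_real, norm_smul, norm_smul, inner_smul_left, inner_smul_right, hw', hq.2,
            hw1]
          simp
        rw [add_sub_cancel_left]
        nlinarith [norm_nonneg (Real.cos s • (q - c) + Real.sin s • w)])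
      simpa using h3
    rcases eq_or_ne v 0 with rfl | h0
    · exact Submodule.zero_mem _
    · have h1 := key (‖v‖⁻¹ • v) (E.smul_mem _ hv) (by simp [inner_smul_right, hv'])
        (by rw [norm_smul, norm_inv, norm_norm, inv_mul_cancel₀ (norm_ne_zero_iff.2 h0)])
      have h2 := Submodule.smul_mem _ ‖v‖ h1
      rwa [smul_smul, mul_inv_cancel₀ (norm_ne_zero_iff.2 h0), one_smul] at h2

/-- The component of the covector in `E` must be radial. This turns orthogonality to the tangent
space into an equation in `x` that can be differentiated. -/
theorem mem_conormal_roundSphere {x : V × V} :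
    x ∈ conormal (roundSphere c E) ↔ x.1 ∈ roundSphere c E ∧
      E.starProjection x.2 = ⟪x.1 - c, x.2⟫_ℝ • (x.1 - c) := by
  rw [conormal, mem_ofPred_eq]
  refine and_congr_right fun hq => ?_
  simp only [mem_tangentSpace_roundSphere hq]
  have hin : ∀ v ∈ E, ⟪E.starProjection x.2, v⟫_ℝ = ⟪x.2, v⟫_ℝ := fun v hv => by
    rw [Submodule.inner_starProjection_left_eq_right, Submodule.starProjection_eq_self_iff.2 hv]
  constructor
  · intro h
    rw [← sub_eq_zero]
    -- The non-radial part of the `E`-component is itself tangent to the sphere, so a conormal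
    -- covector makes it orthogonal to itself.
    set v := E.starProjection x.2 - ⟪x.1 - c, x.2⟫_ℝ • (x.1 - c) with hvd
    have hvE : v ∈ E := E.sub_mem (Submodule.starProjection_apply_mem _ _) (E.smul_mem _ hq.1)
    have h1 : ⟪x.1 - c, v⟫_ℝ = 0 := by
      rw [hvd, inner_sub_right, inner_smul_right, real_inner_self_eq_norm_sq, hq.2,
        real_inner_comm, hin _ hq.1, real_inner_comm]
      ring
    have h2 : ⟪v, v⟫_ℝ = 0 := by
      nth_rewrite 1 [hvd]
      rw [inner_sub_left, inner_smul_left, h1, hin _ hvE, h v ⟨hvE, h1⟩]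
      simp
    exact inner_self_eq_zero.1 h2
  · rintro h v ⟨hv, hv'⟩
    rw [← hin v hv, h, inner_smul_left, hv', mul_zero]

theorem conormalIso_roundSphere {x : V × V} (hq : x.1 ∈ roundSphere c E) (y : V × V) :
    conormalIso (roundSphere c E) x y =
      y.1 + (y.2 - (E.starProjection y.2 - ⟪x.1 - c, y.2⟫_ℝ • (x.1 - c))) := by
  have h : (tangentSpace (roundSphere c E) x.1).starProjection y.2 =
      E.starProjection y.2 - ⟪x.1 - c, y.2⟫_ℝ • (x.1 - c) := by
    have hin : ∀ v ∈ E, ⟪E.starProjection y.2, v⟫_ℝ = ⟪y.2, v⟫_ℝ := fun v hv => by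
      rw [Submodule.inner_starProjection_left_eq_right, Submodule.starProjection_eq_self_iff.2 hv]
    apply Submodule.eq_starProjection_of_mem_of_inner_eq_zero
    · rw [mem_tangentSpace_roundSphere hq]
      refine ⟨E.sub_mem (Submodule.starProjection_apply_mem _ _) (E.smul_mem _ hq.1), ?_⟩
      rw [inner_sub_right, inner_smul_right, real_inner_self_eq_norm_sq, hq.2,
        real_inner_comm, hin _ hq.1, real_inner_comm]
      ring
    · intro w hw
      rw [mem_tangentSpace_roundSphere hq] at hw
      rw [inner_sub_left, inner_sub_left, inner_smul_left, hin _ hw.1, hw.2]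
      simp
  simp only [conormalIso, LinearMap.add_apply, LinearMap.fst_apply, LinearMap.comp_apply,
    LinearMap.snd_apply, Submodule.starProjection_orthogonal_val, ContinuousLinearMap.coe_coe, h]

/-- These are the derivatives of the sphere condition on the base point and of the equation in
`mem_conormal_roundSphere`. -/
theorem of_mem_tangentSpace_conormal_roundSphere {x : V × V}
    (hx : x ∈ conormal (roundSphere c E)) {y : V × V}
    (hy : y ∈ tangentSpace (conormal (roundSphere c E)) x) :
    (y.1 ∈ E ∧ ⟪x.1 - c, y.1⟫_ℝ = 0) ∧ E.starProjection y.2 =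
      ⟪x.1 - c, x.2⟫_ℝ • y.1 + (⟪x.1 - c, y.2⟫_ℝ + ⟪y.1, x.2⟫_ℝ) • (x.1 - c) := by
  constructor
  · rw [← mem_tangentSpace_roundSphere hx.1]
    exact apply_mem_tangentSpace
      (hasFDerivAt_fst (𝕜 := ℝ) (p := x)).hasFDerivWithinAt (fun z hz => hz.1) hy
  · have d1 : HasFDerivAt (fun z : V × V => z.1 - c) (ContinuousLinearMap.fst ℝ V V) x :=
      (hasFDerivAt_fst (𝕜 := ℝ) (p := x)).sub_const c
    have d2 : HasFDerivAt (fun z : V × V => E.starProjection z.2)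
        (E.starProjection ∘L ContinuousLinearMap.snd ℝ V V) x :=
      E.starProjection.hasFDerivAt.comp x (hasFDerivAt_snd (𝕜 := ℝ) (p := x))
    have d3 := d2.sub ((d1.inner ℝ (hasFDerivAt_snd (𝕜 := ℝ) (p := x))).smul d1)
    have h := hasFDerivWithinAt_apply_eq_zero d3.hasFDerivWithinAt hx (c := 0)
      (fun z hz => by
        have := (mem_conormal_roundSphere.1 hz).2
        simp [this]) hy
    have h' := sub_eq_zero.1 h
    simpa [fderivInnerCLM_apply] using h'

/-- Projecting the vanishing sum to `E` leaves a tangent vector plus a radial vector; these are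
orthogonal, so both vanish. The linearized conormal equation then kills the `E`-component of `y.2`,
and the vanishing sum kills the rest. -/
theorem conormalIso_roundSphere_injOn {x : V × V} (hx : x ∈ conormal (roundSphere c E))
    {y : V × V} (hy : y ∈ tangentSpace (conormal (roundSphere c E)) x)
    (h0 : conormalIso (roundSphere c E) x y = 0) : y = 0 := by
  obtain ⟨⟨h1, h2⟩, h3⟩ := of_mem_tangentSpace_conormal_roundSphere hx hy
  rw [conormalIso_roundSphere hx.1] at h0
  have hu := hx.1
  have h4 : y.1 + ⟪x.1 - c, y.2⟫_ℝ • (x.1 - c) = 0 := by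
    have := congrArg E.starProjection h0
    simp only [map_add, map_sub, map_smul, map_zero, Submodule.starProjection_eq_self_iff.2 h1,
      Submodule.starProjection_eq_self_iff.2 hu.1,
      Submodule.starProjection_eq_self_iff.2 (Submodule.starProjection_apply_mem E y.2)] at this
    rw [← this]; abel
  have h5 : ⟪x.1 - c, y.2⟫_ℝ = 0 := by
    have := congrArg (fun w => ⟪x.1 - c, w⟫_ℝ) h4
    simpa [inner_add_right, inner_smul_right, h2, real_inner_self_eq_norm_sq, hu.2] using this
  have h6 : y.1 = 0 := by simpa [h5] using h4
  have h7 : E.starProjection y.2 = 0 := by simpa [h5, h6] using h3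
  have h8 : y.2 = 0 := by simpa [h5, h6, h7] using h0
  exact Prod.ext h6 h8

end RoundSphere

/-! ### Submanifolds that are locally round spheres -/

section SphereUnion

variable {V : Type} [NormedAddCommGroup V] [InnerProductSpace ℝ V]

/-- Every point of `K` has a neighbourhood in which `K` is a round unit sphere of dimension
`d - 1`. -/
def IsSphereUnion (d : ℕ) (K : Set V) : Prop :=
  ∀ q ∈ K, ∃ (c : V) (E : Submodule ℝ V), Module.finrank ℝ E = d ∧ q ∈ roundSphere c E ∧
    ∀ᶠ q' in 𝓝 q, q' ∈ K ↔ q' ∈ roundSphere c E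

theorem isSphereUnion_union {d : ℕ} {c c' : V} {E E' : Submodule ℝ V}
    (hE : Module.finrank ℝ E = d) (hE' : Module.finrank ℝ E' = d)
    (hc : IsClosed (roundSphere c E)) (hc' : IsClosed (roundSphere c' E'))
    (hdisj : Disjoint (roundSphere c E) (roundSphere c' E')) :
    IsSphereUnion d (roundSphere c E ∪ roundSphere c' E') := by
  rintro q (hq | hq)
  · exact ⟨c, E, hE, hq, eventually_mem_union_iff_left hc' hdisj hq⟩
  · exact ⟨c', E', hE', hq, eventually_mem_union_iff_right hc hdisj hq⟩

variable [FiniteDimensional ℝ V] {d : ℕ} {K : Set V}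

theorem isClosed_roundSphere (c : V) (E : Submodule ℝ V) : IsClosed (roundSphere c E) :=
  (E.closed_of_finiteDimensional.preimage (by fun_prop : Continuous fun q : V => q - c)).inter
    (isClosed_eq (by fun_prop) continuous_const)

theorem IsSphereUnion.conormalIso_injOn (hK : IsSphereUnion d K) {x : V × V}
    (hx : x ∈ conormal K) {y : V × V} (hy : y ∈ tangentSpace (conormal K) x)
    (h0 : conormalIso K x y = 0) : y = 0 := by
  obtain ⟨c, E, -, -, h⟩ := hK x.1 hx.1
  have h1 := eventually_mem_conormal_iff h
  rw [tangentSpace_congr h1] at hy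
  rw [conormalIso_congr h] at h0
  exact conormalIso_roundSphere_injOn (h1.self_of_nhds.1 hx) hy h0

theorem IsSphereUnion.continuousOn_conormalIso (hK : IsSphereUnion d K) :
    ContinuousOn (fun a : (V × V) × (V × V) => conormalIso K a.1 a.2) {a | a.1.1 ∈ K} := by
  intro a ha
  obtain ⟨c, E, -, hq, h⟩ := hK a.1.1 ha
  have h1 : ∀ᶠ b : (V × V) × (V × V) in 𝓝 a, ∀ᶠ q in 𝓝 b.1.1, q ∈ K ↔ q ∈ roundSphere c E :=
    (by fun_prop : Continuous fun b : (V × V) × (V × V) => b.1.1).continuousAt.eventually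
      h.eventually_nhds
  have h2 : ContinuousWithinAt (fun b : (V × V) × (V × V) => b.2.1 + (b.2.2 -
      (E.starProjection b.2.2 - ⟪b.1.1 - c, b.2.2⟫_ℝ • (b.1.1 - c)))) {a | a.1.1 ∈ K} a := by
    fun_prop
  refine h2.congr_of_eventuallyEq ?_ ?_
  · filter_upwards [nhdsWithin_le_nhds h1, self_mem_nhdsWithin] with b hb hb'
    rw [conormalIso_congr hb, conormalIso_roundSphere (hb.self_of_nhds.1 hb')]
  · rw [conormalIso_congr h, conormalIso_roundSphere hq]

/-- This upper bound suffices later: linearly independent tangent vectors as many as the dimension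
of `V` must span. -/
theorem IsSphereUnion.finrank_tangentSpace_conormal_le (hK : IsSphereUnion d K) {x : V × V}
    (hx : x ∈ conormal K) :
    Module.finrank ℝ (tangentSpace (conormal K) x) ≤ Module.finrank ℝ V := by
  refine LinearMap.finrank_le_finrank_of_injective
    (f := (conormalIso K x).domRestrict (tangentSpace (conormal K) x)) ?_
  rw [← LinearMap.ker_eq_bot, LinearMap.ker_eq_bot']
  exact fun y hy => Subtype.ext (hK.conormalIso_injOn hx y.2 hy)

end SphereUnion

/-! ### Smooth embeddings and submanifolds -/

section Submanifold

variable {V W X : Type} [NormedAddCommGroup V] [NormedSpace ℝ V]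
  [NormedAddCommGroup W] [NormedSpace ℝ W] [NormedAddCommGroup X] [NormedSpace ℝ X]

theorem IsSmoothEmbeddingOn.mono {f : V → W} {S T : Set V} (hf : IsSmoothEmbeddingOn f T)
    (h : S ⊆ T) : IsSmoothEmbeddingOn f S := by
  obtain ⟨h1, g, hg, hl⟩ := hf
  exact ⟨h1.mono h, g, hg.mono (image_mono h), hl.mono h⟩

theorem IsSmoothEmbeddingOn.comp {g : W → X} {f : V → W} {S : Set V}
    (hg : IsSmoothEmbeddingOn g (f '' S)) (hf : IsSmoothEmbeddingOn f S) :
    IsSmoothEmbeddingOn (g ∘ f) S := by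
  obtain ⟨h1, f', hf', hl⟩ := hf
  obtain ⟨h2, g', hg', hr⟩ := hg
  refine ⟨h2.comp h1 (mapsTo_image _ _), f' ∘ g', ?_, fun x hx => ?_⟩
  · rw [image_comp]
    refine hf'.comp hg' ?_
    rintro _ ⟨y, hy, rfl⟩
    rwa [hr hy]
  · simp [hr (mem_image_of_mem f hx), hl hx]

theorem IsSmoothSubmanifold.image {k : ℕ} {S : Set V} (hS : IsSmoothSubmanifold k S) {f : V → W}
    (hf : IsSmoothEmbeddingOn f S) : IsSmoothSubmanifold k (f '' S) := by
  rintro _ ⟨x, hx, rfl⟩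
  obtain ⟨U, hU, hxU, O, hO, φ, hφ, hφO⟩ := hS x hx
  obtain ⟨g, hg, hl⟩ := hf.2
  -- Continuity of the inverse on the image provides an open set of the target that cuts out the
  -- image of the chart domain.
  obtain ⟨U', hU', hUU'⟩ := continuousOn_iff'.1 hg.continuousOn U hU
  have hmem : ∀ y ∈ S, (f y ∈ U' ↔ y ∈ U) := fun y hy => by
    have h1 := Set.ext_iff.1 hUU' (f y)
    simp only [mem_inter_iff, mem_preimage, mem_image_of_mem f hy, and_true, hl hy] at h1
    exact h1.symm
  refine ⟨U', hU', (hmem x hx).2 hxU, O, hO, f ∘ φ, ?_, ?_⟩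
  · refine IsSmoothEmbeddingOn.comp (hf.mono ?_) hφ
    rw [hφO]; exact inter_subset_left
  · rw [image_comp, hφO]
    ext w
    constructor
    · rintro ⟨y, hy, rfl⟩
      exact ⟨⟨y, hy.1, rfl⟩, (hmem y hy.1).2 hy.2⟩
    · rintro ⟨⟨y, hy, rfl⟩, hw⟩
      exact ⟨y, ⟨hy, (hmem y hy).1 hw⟩, rfl⟩

theorem IsSmoothSubmanifold.prod {k l : ℕ} {S : Set V} {T : Set W}
    (hS : IsSmoothSubmanifold k S) (hT : IsSmoothSubmanifold l T) :
    IsSmoothSubmanifold (k + l) (S ×ˢ T) := by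
  rintro ⟨x, y⟩ ⟨hx, hy⟩
  obtain ⟨U, hU, hxU, O, hO, φ, ⟨hφ, g, hg, hgl⟩, hφO⟩ := hS x hx
  obtain ⟨U', hU', hxU', O', hO', φ', ⟨hφ', g', hg', hgl'⟩, hφO'⟩ := hT y hy
  let e : EuclideanSpace ℝ (Fin (k + l)) ≃L[ℝ]
      EuclideanSpace ℝ (Fin k) × EuclideanSpace ℝ (Fin l) :=
    ContinuousLinearEquiv.ofFinrankEq (by simp)
  have himg : (Prod.map φ φ' ∘ e) '' (e ⁻¹' (O ×ˢ O')) = (S ∩ U) ×ˢ (T ∩ U') := by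
    rw [image_comp, image_preimage_eq _ e.surjective, prodMap_image_prod, hφO, hφO']
  refine ⟨U ×ˢ U', hU.prod hU', ⟨hxU, hxU'⟩, e ⁻¹' (O ×ˢ O'),
    (hO.prod hO').preimage e.continuous, Prod.map φ φ' ∘ e, ⟨?_, e.symm ∘ Prod.map g g', ?_, ?_⟩, ?_⟩
  · exact (hφ.prodMap hφ').comp e.contDiff.contDiffOn fun _ h => h
  · rw [himg, ← hφO, ← hφO']
    exact e.symm.contDiff.comp_contDiffOn (hg.prodMap hg')
  · intro v hv
    simp only [Function.comp_apply, Prod.map]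
    rw [hgl hv.1, hgl' hv.2]
    exact e.symm_apply_apply v
  · rw [himg, prod_inter_prod]

theorem isSmoothSubmanifold_of_eventually {k : ℕ} {S : Set V}
    (h : ∀ x ∈ S, ∃ T : Set V, IsSmoothSubmanifold k T ∧ ∀ᶠ y in 𝓝 x, y ∈ S ↔ y ∈ T) :
    IsSmoothSubmanifold k S := by
  intro x hx
  obtain ⟨T, hT, hST⟩ := h x hx
  obtain ⟨U, hU, hxU, O, hO, φ, hφ, hφO⟩ := hT x (hST.self_of_nhds.1 hx)
  obtain ⟨N, hN, hNo, hxN⟩ := eventually_nhds_iff.1 hST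
  refine ⟨U ∩ N, hU.inter hNo, ⟨hxU, hxN⟩, O ∩ φ ⁻¹' N,
    hφ.1.continuousOn.isOpen_inter_preimage hO hNo, φ, hφ.mono inter_subset_left, ?_⟩
  rw [image_inter_preimage, hφO]
  ext y
  constructor
  · rintro ⟨⟨h1, h2⟩, h3⟩; exact ⟨(hN y h3).2 h1, h2, h3⟩
  · rintro ⟨h1, h2, h3⟩; exact ⟨⟨(hN y h3).1 h1, h2⟩, h3⟩

end Submanifold

/-! ### Smoothness of round spheres and their unit conormal bundles -/

section Spheres

variable {V : Type} [NormedAddCommGroup V] [InnerProductSpace ℝ V] [FiniteDimensional ℝ V]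

theorem finrank_tangentSpace_roundSphere {c q : V} {E : Submodule ℝ V}
    (hq : q ∈ roundSphere c E) :
    1 + Module.finrank ℝ (tangentSpace (roundSphere c E) q) = Module.finrank ℝ E := by
  have h0 : q - c ≠ 0 := fun h => by simpa [h] using hq.2
  have h1 : ℝ ∙ (q - c) ≤ E := (Submodule.span_singleton_le_iff_mem _ _).2 hq.1
  have h2 := Submodule.finrank_add_inf_finrank_orthogonal h1
  rw [finrank_span_singleton h0] at h2
  have h3 : tangentSpace (roundSphere c E) q = (ℝ ∙ (q - c))ᗮ ⊓ E := by
    ext v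
    rw [mem_tangentSpace_roundSphere hq, Submodule.mem_inf,
      Submodule.mem_orthogonal_singleton_iff_inner_right, and_comm]
  rw [h3, h2]

/-- The chart around `u` is central projection from the tangent hyperplane in `E` to the open
hemisphere. Its inverse rescales `w` to have inner product one with `u` and then projects to the
tangent space, which removes `u`. -/
theorem isSmoothSubmanifold_roundSphere {k : ℕ} {E : Submodule ℝ V}
    (hE : Module.finrank ℝ E = k + 1) : IsSmoothSubmanifold k (roundSphere 0 E) := by
  intro u hu
  have hu1 : ‖u‖ = 1 := by simpa using hu.2
  have huE : u ∈ E := by simpa using hu.1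
  set F := tangentSpace (roundSphere 0 E) u with hF
  have hFk : Module.finrank ℝ F = k := by
    have := finrank_tangentSpace_roundSphere hu
    rw [← hF] at this
    omega
  have hFm : ∀ v, v ∈ F ↔ v ∈ E ∧ ⟪u, v⟫_ℝ = 0 := fun v => by
    simpa using mem_tangentSpace_roundSphere hu (v := v)
  let J : EuclideanSpace ℝ (Fin k) ≃L[ℝ] F := ContinuousLinearEquiv.ofFinrankEq (by simp [hFk])
  have hJ : ∀ h, ⟪u, (J h : V)⟫_ℝ = 0 := fun h => ((hFm _).1 (J h).2).2
  have hne : ∀ h, u + (J h : V) ≠ 0 := fun h h0 => by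
    have := congrArg (fun w => ⟪u, w⟫_ℝ) h0
    simp [inner_add_right, hJ, hu1] at this
  have hpos : ∀ h, 0 < ‖u + (J h : V)‖ := fun h => norm_pos_iff.2 (hne h)
  have hin : ∀ h, ⟪u, ‖u + (J h : V)‖⁻¹ • (u + (J h : V))⟫_ℝ = ‖u + (J h : V)‖⁻¹ := fun h => by
    simp [inner_smul_right, inner_add_right, hJ, hu1]
  have hproj : F.orthogonalProjectionOnto u = 0 := by
    rw [Submodule.orthogonalProjectionOnto_eq_zero_iff, Submodule.mem_orthogonal]
    intro v hv
    rw [real_inner_comm]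
    exact ((hFm v).1 hv).2
  have himg : (fun h => ‖u + (J h : V)‖⁻¹ • (u + (J h : V))) '' univ =
      roundSphere 0 E ∩ {w | 0 < ⟪u, w⟫_ℝ} := by
    ext w
    constructor
    · rintro ⟨h, -, rfl⟩
      refine ⟨⟨?_, ?_⟩, ?_⟩
      · rw [sub_zero]
        exact E.smul_mem _ (E.add_mem huE ((hFm _).1 (J h).2).1)
      · rw [sub_zero, norm_smul, norm_inv, norm_norm, inv_mul_cancel₀ (hpos h).ne']
      · rw [mem_ofPred_eq, hin]; exact inv_pos.2 (hpos h)
    · rintro ⟨hw, hw'⟩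
      have hw' : 0 < ⟪u, w⟫_ℝ := hw'
      have hw1 : ‖w‖ = 1 := by simpa using hw.2
      have hwE : w ∈ E := by simpa using hw.1
      have hm : (⟪u, w⟫_ℝ)⁻¹ • w - u ∈ F := by
        rw [hFm]
        refine ⟨E.sub_mem (E.smul_mem _ hwE) huE, ?_⟩
        rw [inner_sub_right, inner_smul_right, real_inner_self_eq_norm_sq, hu1,
          inv_mul_cancel₀ hw'.ne']
        norm_num
      refine ⟨J.symm ⟨_, hm⟩, trivial, ?_⟩
      simp only [ContinuousLinearEquiv.apply_symm_apply, add_sub_cancel]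
      rw [norm_smul, hw1, mul_one, norm_inv, inv_inv, Real.norm_of_nonneg hw'.le, smul_smul,
        mul_inv_cancel₀ hw'.ne', one_smul]
  refine ⟨{w | 0 < ⟪u, w⟫_ℝ}, isOpen_lt continuous_const (by fun_prop), ?_, univ, isOpen_univ,
    fun h => ‖u + (J h : V)‖⁻¹ • (u + (J h : V)), ⟨?_,
      fun w => J.symm (F.orthogonalProjectionOnto ((⟪u, w⟫_ℝ)⁻¹ • w)), ?_, ?_⟩, himg⟩
  · simp [hu1]
  · have h1 : ContDiff ℝ ∞ fun h => u + (J h : V) :=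
      contDiff_const.add (F.subtypeL.contDiff.comp J.contDiff)
    have h2 : ContDiff ℝ ∞ fun h => ‖u + (J h : V)‖ := h1.norm ℝ hne
    exact ((h2.inv fun h => (hpos h).ne').smul h1).contDiffOn
  · rw [himg]
    have h1 : ContDiffOn ℝ ∞ (fun w => (⟪u, w⟫_ℝ)⁻¹ • w)
        (roundSphere 0 E ∩ {w | 0 < ⟪u, w⟫_ℝ}) :=
      ((contDiff_const.inner ℝ contDiff_id).contDiffOn.inv fun w hw => hw.2.ne').smul
        contDiff_id.contDiffOn
    exact J.symm.contDiff.comp_contDiffOn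
      (F.orthogonalProjectionOnto.contDiff.comp_contDiffOn h1)
  · intro h _
    simp only []
    rw [hin, inv_inv, smul_smul, mul_inv_cancel₀ (hpos h).ne', one_smul, map_add, hproj, zero_add,
      Submodule.orthogonalProjectionOnto_mem_subspace_eq_self, J.symm_apply_apply]

/-- The normal bundle of the sphere is trivial: each fibre is the radial line plus the constant
space `Eᗮ`. Hence the unit conormal bundle is diffeomorphic to the product of the unit sphere of `E`
and the unit sphere of the normal space `N` at a base point `u`. -/
theorem isSmoothSubmanifold_unitConormal_roundSphere {k l : ℕ} (c : V) {E : Submodule ℝ V}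
    (hE : Module.finrank ℝ E = k + 1) (hV : Module.finrank ℝ V = k + l + 1) :
    IsSmoothSubmanifold (k + l) (unitConormal (roundSphere c E)) := by
  have : Nontrivial E := Module.nontrivial_of_finrank_eq_succ hE
  obtain ⟨⟨u, huE⟩, hu1⟩ := exists_norm_eq E (zero_le_one' ℝ)
  have hu1 : ‖u‖ = 1 := hu1
  have hu : u ∈ roundSphere 0 E := ⟨by simpa using huE, by simpa using hu1⟩
  set N := (tangentSpace (roundSphere 0 E) u)ᗮ with hN
  have hNl : Module.finrank ℝ N = l + 1 := by
    have h1 := finrank_tangentSpace_roundSphere hu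
    have h2 := (tangentSpace (roundSphere 0 E) u).finrank_add_finrank_orthogonal
    rw [← hN] at h2
    omega
  have hNm : ∀ m, m ∈ N ↔ E.starProjection m = ⟪u, m⟫_ℝ • u := fun m => by
    have h1 := mem_conormal_roundSphere (c := 0) (E := E) (x := (u, m))
    simp only [conormal, mem_ofPred_eq, hu, true_and, sub_zero] at h1
    rw [← h1, hN, Submodule.mem_orthogonal']
  -- The radial coefficient along `u` is transferred to `v`, while the part in `Eᗮ` is unchanged;
  -- `g` transfers it back.
  let f : V × V → V × V := fun y => (c + y.1, ⟪u, y.2⟫_ℝ • y.1 + Eᗮ.starProjection y.2)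
  let g : V × V → V × V := fun x => (x.1 - c, ⟪x.1 - c, x.2⟫_ℝ • u + Eᗮ.starProjection x.2)
  have hf : ContDiff ℝ ∞ f :=
    (contDiff_const.add contDiff_fst).prodMk (((contDiff_const.inner ℝ contDiff_snd).smul
      contDiff_fst).add (Eᗮ.starProjection.contDiff.comp contDiff_snd))
  have hg : ContDiff ℝ ∞ g :=
    (contDiff_fst.sub contDiff_const).prodMk ((((contDiff_fst.sub contDiff_const).inner ℝ
      contDiff_snd).smul contDiff_const).add (Eᗮ.starProjection.contDiff.comp contDiff_snd))
  have hort : ∀ v ∈ E, ∀ w, ⟪v, Eᗮ.starProjection w⟫_ℝ = 0 := fun v hv w =>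
    Submodule.inner_right_of_mem_orthogonal hv (Submodule.starProjection_apply_mem _ _)
  have hnorm : ∀ v ∈ E, ‖v‖ = 1 → ∀ (a : ℝ) (w : V),
      ‖a • v + Eᗮ.starProjection w‖ ^ 2 = a ^ 2 + ‖Eᗮ.starProjection w‖ ^ 2 := by
    intro v hv hv1 a w
    rw [norm_add_sq_real, inner_smul_left, hort v hv, norm_smul, hv1]
    simp
  have hpE : ∀ v ∈ E, Eᗮ.starProjection v = 0 := fun v hv => by
    rw [Submodule.starProjection_apply_eq_zero_iff, Submodule.orthogonal_orthogonal]; exact hv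
  have hpN : ∀ w, Eᗮ.starProjection (Eᗮ.starProjection w) = Eᗮ.starProjection w := fun w =>
    Submodule.starProjection_eq_self_iff.2 (Submodule.starProjection_apply_mem _ _)
  have hEN : ∀ w, E.starProjection (Eᗮ.starProjection w) = 0 := fun w => by
    rw [Submodule.starProjection_apply_eq_zero_iff]; exact Submodule.starProjection_apply_mem _ _
  have hdec : ∀ w, E.starProjection w + Eᗮ.starProjection w = w := fun w =>
    Submodule.starProjection_add_starProjection_orthogonal w
  have hS : IsSmoothSubmanifold (k + l) (roundSphere 0 E ×ˢ roundSphere 0 N) :=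
    (isSmoothSubmanifold_roundSphere hE).prod (isSmoothSubmanifold_roundSphere hNl)
  have hgf : ∀ y ∈ roundSphere 0 E ×ˢ roundSphere 0 N, g (f y) = y := by
    rintro ⟨v, m⟩ ⟨⟨hv, hv1⟩, ⟨hm, hm1⟩⟩
    simp only [sub_zero] at hv hv1 hm hm1
    have h1 := (hNm m).1 hm
    simp only [f, g, add_sub_cancel_left, map_add, map_smul, hpE v hv, hpN, smul_zero, zero_add,
      inner_add_right, inner_smul_right, real_inner_self_eq_norm_sq, hv1, hort v hv, add_zero]
    rw [one_pow, mul_one, ← h1, hdec]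
  have himg : f '' (roundSphere 0 E ×ˢ roundSphere 0 N) = unitConormal (roundSphere c E) := by
    ext x
    constructor
    · rintro ⟨⟨v, m⟩, ⟨⟨hv, hv1⟩, ⟨hm, hm1⟩⟩, rfl⟩
      simp only [sub_zero] at hv hv1 hm hm1
      have h1 := (hNm m).1 hm
      refine ⟨mem_conormal_roundSphere.2 ⟨⟨?_, ?_⟩, ?_⟩, ?_⟩
      · simpa [f] using hv
      · simpa [f] using hv1
      · simp only [f, add_sub_cancel_left, map_add, map_smul, hEN,
          Submodule.starProjection_eq_self_iff.2 hv, inner_add_right, inner_smul_right,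
          real_inner_self_eq_norm_sq, hv1, hort v hv, one_pow, mul_one, add_zero]
      · have h2 : ‖⟪u, m⟫_ℝ • v + Eᗮ.starProjection m‖ ^ 2 = 1 ^ 2 := by
          rw [hnorm v hv hv1, ← hnorm u huE hu1, ← h1, hdec, hm1]
        exact (sq_eq_sq₀ (norm_nonneg _) zero_le_one).1 h2
    · rintro ⟨hx, hx1⟩
      obtain ⟨⟨hv, hv1⟩, hp⟩ := mem_conormal_roundSphere.1 hx
      refine ⟨g x, ⟨⟨by simpa [g] using hv, by simpa [g] using hv1⟩, ?_, ?_⟩, ?_⟩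
      · rw [sub_zero, hNm]
        simp only [g, map_add, map_smul, hEN, Submodule.starProjection_eq_self_iff.2 huE,
          inner_add_right, inner_smul_right, real_inner_self_eq_norm_sq, hu1, hort u huE, one_pow,
          mul_one, add_zero]
      · have h2 : ‖⟪x.1 - c, x.2⟫_ℝ • u + Eᗮ.starProjection x.2‖ ^ 2 = 1 ^ 2 := by
          rw [hnorm u huE hu1, ← hnorm _ hv hv1, ← hp, hdec, show ‖x.2‖ = 1 from hx1]
        rw [sub_zero]
        exact (sq_eq_sq₀ (norm_nonneg _) zero_le_one).1 h2
      · refine Prod.ext (by simp [f, g]) ?_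
        simp only [f, g, map_add, map_smul, hpE u huE, hpN, smul_zero, zero_add,
          inner_add_right, inner_smul_right, real_inner_self_eq_norm_sq, hu1, hort u huE, add_zero]
        rw [one_pow, mul_one, ← hp, hdec]
  rw [← himg]
  exact hS.image ⟨hf.contDiffOn, g, hg.contDiffOn, hgf⟩

theorem IsSphereUnion.isSmoothSubmanifold_unitConormal {k l : ℕ} {K : Set V}
    (hK : IsSphereUnion (k + 1) K) (hV : Module.finrank ℝ V = k + l + 1) :
    IsSmoothSubmanifold (k + l) (unitConormal K) :=
  isSmoothSubmanifold_of_eventually fun x hx => by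
    obtain ⟨c, E, hE, -, h⟩ := hK x.1 hx.1.1
    exact ⟨_, isSmoothSubmanifold_unitConormal_roundSphere c hE hV,
      eventually_mem_unitConormal_iff h⟩

end Spheres

/-! ### Pullbacks of coverings and of spin structures -/

theorem isCoveringMap_pullback {E X Y : Type*} [TopologicalSpace E] [TopologicalSpace X]
    [TopologicalSpace Y] {p : E → X} (hp : IsCoveringMap p) {g : Y → X} (hg : Continuous g) :
    IsCoveringMap fun z : {z : E × Y // p z.1 = g z.2} => z.1.2 := by
  intro y
  obtain ⟨hI, U, hyU, hU, hpU, H, hH⟩ := hp (g y)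
  have hH' : ∀ w, p (H.symm w) = w.1 := fun w => by rw [← hH, H.apply_symm_apply]
  refine IsEvenlyCovered.to_isEvenlyCovered_preimage (I := p ⁻¹' {g y})
    ⟨hI, g ⁻¹' U, hyU, hU.preimage hg, (hU.preimage hg).preimage (by fun_prop), ?_⟩
  have hmem : ∀ z : {z : E × Y // p z.1 = g z.2}, g z.1.2 ∈ U → z.1.1 ∈ p ⁻¹' U :=
    fun z hz => by rw [mem_preimage, z.2]; exact hz
  refine ⟨{
      toFun := fun z => (⟨z.1.1.2, z.2⟩, (H ⟨z.1.1.1, hmem z.1 z.2⟩).2)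
      invFun := fun w => ⟨⟨(H.symm (⟨g w.1, w.1.2⟩, w.2), w.1), hH' _⟩, w.1.2⟩
      left_inv := fun z => ?_
      right_inv := fun w => ?_
      continuous_toFun := by fun_prop
      continuous_invFun := by fun_prop }, fun _ => rfl⟩
  · obtain ⟨⟨⟨e, y'⟩, hz⟩, hz'⟩ := z
    have h1 : H ⟨e, hmem ⟨⟨e, y'⟩, hz⟩ hz'⟩ = (⟨g y', hz'⟩, (H ⟨e, hmem ⟨⟨e, y'⟩, hz⟩ hz'⟩).2) :=
      Prod.ext (Subtype.ext ((hH _).trans hz)) rfl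
    apply Subtype.ext
    apply Subtype.ext
    refine Prod.ext ?_ rfl
    change ((H.symm (⟨g y', hz'⟩, (H ⟨e, hmem ⟨⟨e, y'⟩, hz⟩ hz'⟩).2) : p ⁻¹' U) : E) = e
    rw [← h1, H.symm_apply_apply]
  · refine Prod.ext rfl ?_
    change (H ⟨(H.symm (⟨g w.1, w.1.2⟩, w.2) : p ⁻¹' U), _⟩).2 = w.2
    rw [Subtype.coe_eta, H.apply_symm_apply]

section FrameBundle

variable {V W : Type} [NormedAddCommGroup V] [NormedSpace ℝ V]
  [NormedAddCommGroup W] [NormedSpace ℝ W]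

theorem frame_sum_mem_frameBundle {k : ℕ} {S : Set V} {x : V} {f : Fin k → V}
    {g : Matrix (Fin k) (Fin k) ℝ} (h : (x, f) ∈ frameBundle S k) (hg : g.det ≠ 0) :
    (x, fun j => ∑ i, g i j • f i) ∈ frameBundle S k := by
  obtain ⟨hx, hf, hs⟩ := h
  simp only at hx hf hs
  have hspan : Submodule.span ℝ (range fun j => ∑ i, g i j • f i) = Submodule.span ℝ (range f) := by
    apply le_antisymm
    · rw [Submodule.span_le]
      rintro _ ⟨j, rfl⟩
      exact Submodule.sum_mem _ fun i _ => Submodule.smul_mem _ _ (Submodule.subset_span ⟨i, rfl⟩)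
    · rw [Submodule.span_le]
      rintro _ ⟨i, rfl⟩
      have h1 : f i = ∑ j, g⁻¹ j i • ∑ m, g m j • f m := by
        simp_rw [Finset.smul_sum, smul_smul]
        rw [Finset.sum_comm]
        simp_rw [← Finset.sum_smul, mul_comm (g⁻¹ _ i), ← Matrix.mul_apply,
          Matrix.mul_nonsing_inv g (isUnit_iff_ne_zero.2 hg), Matrix.one_apply]
        simp
      rw [h1]
      exact Submodule.sum_mem _ fun j _ => Submodule.smul_mem _ _ (Submodule.subset_span ⟨j, rfl⟩)
  refine ⟨hx, ?_, hspan.trans hs⟩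
  rw [linearIndependent_iff_card_eq_finrank_span] at hf ⊢
  rw [Set.finrank] at hf ⊢
  rw [hspan, ← hf]

theorem rotateFrame_map {k : ℕ} (L : V →ₗ[ℝ] W) (i j : Fin k) (θ : ℝ) (f : Fin k → V) :
    (fun m => L (rotateFrame i j θ f m)) = rotateFrame i j θ fun m => L (f m) := by
  ext m
  simp only [rotateFrame, Function.update_apply]
  split_ifs <;> simp

theorem rotateFrame_cons {k : ℕ} (v : V) (i j : Fin k) (θ : ℝ) (f : Fin k → V) :
    (Fin.cons v (rotateFrame i j θ f) : Fin (k + 1) → V) =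
      rotateFrame i.succ j.succ θ (Fin.cons v f : Fin (k + 1) → V) := by
  simp only [rotateFrame, Fin.cons_update, Fin.cons_succ]

/-- The pullback of a spin structure along a continuous map of frame bundles that is compatible
with changes of frames. -/
theorem IsSpinStructure.pullback {k l : ℕ} {S : Set V} {σ : FrameCover.{u} V k}
    (hσ : IsSpinStructure S σ) {S' : Set W} {φ : W × (Fin l → W) → V × (Fin k → V)}
    (hφ : MapsTo φ (frameBundle S' l) (frameBundle S k))
    (hcont : ContinuousOn φ (frameBundle S' l))
    (hdet : ∀ (x : W) (f : Fin l → W) (g : Matrix (Fin l) (Fin l) ℝ),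
      ∃ g' : Matrix (Fin k) (Fin k) ℝ, g'.det = g.det ∧
        φ (x, fun j => ∑ i, g i j • f i) =
          ((φ (x, f)).1, fun j => ∑ i, g' i j • (φ (x, f)).2 i))
    {ι : Fin l → Fin k} (hι : Function.Injective ι)
    (hrot : ∀ (x : W) (f : Fin l → W) (i j : Fin l) (θ : ℝ),
      φ (x, rotateFrame i j θ f) = ((φ (x, f)).1, rotateFrame (ι i) (ι j) θ (φ (x, f)).2)) :
    IsSpinStructure S' (σ.pullback (frameBundle S' l) φ) := by
  have hrange : ∀ a, a ∈ range (σ.pullback (frameBundle S' l) φ).proj ↔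
      a ∈ frameBundle S' l ∧ φ a ∈ range σ.proj := by
    intro a
    constructor
    · rintro ⟨y, rfl⟩
      exact ⟨y.2.1, y.1.1, y.2.2⟩
    · rintro ⟨ha, e, he⟩
      exact ⟨⟨(e, a), ha, he⟩, rfl⟩
  refine ⟨fun y => y.2.1, ?_, ?_, ?_, ?_, ?_⟩
  · intro x f g hf hg
    obtain ⟨g', hg', h1⟩ := hdet x f g
    rw [hrange, hrange, h1]
    simp only [hf, frame_sum_mem_frameBundle hf hg, true_and]
    rw [hσ.orientation (φ (x, f)).1 (φ (x, f)).2 g' (hφ hf) (by rwa [hg']), hg']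
  · let Φ : frameBundle S' l → frameBundle S k := fun a => ⟨φ a, hφ a.2⟩
    have hΦ : Continuous Φ :=
      (continuousOn_iff_continuous_domRestrict.1 hcont).subtype_mk _
    convert hσ.isOpen_positive.preimage hΦ using 1
    ext a
    change (a : W × (Fin l → W)) ∈ range _ ↔ φ a ∈ range _
    rw [hrange]
    exact and_iff_right a.2
  · let Y := range (σ.pullback (frameBundle S' l) φ).proj
    let g : Y → range σ.proj := fun a => ⟨φ a, ((hrange a).1 a.2).2⟩
    have hg : Continuous g := by
      refine Continuous.subtype_mk ?_ _
      exact (hcont.mono fun a ha => ((hrange a).1 ha).1).domRestrict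
    have h1 := isCoveringMap_pullback hσ.isCoveringMap hg
    let e : (σ.pullback (frameBundle S' l) φ).carrier ≃ₜ
        {z : σ.carrier × Y // rangeFactorization σ.proj z.1 = g z.2} :=
      { toFun := fun y => ⟨(y.1.1, ⟨y.1.2, y, rfl⟩), Subtype.ext y.2.2⟩
        invFun := fun z => ⟨(z.1.1, z.1.2), ((hrange _).1 z.1.2.2).1, congrArg Subtype.val z.2⟩
        left_inv := fun y => rfl
        right_inv := fun z => rfl
        continuous_toFun := by
          refine Continuous.subtype_mk (Continuous.prodMk ?_ (Continuous.subtype_mk ?_ _)) _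
          · exact continuous_fst.comp continuous_subtype_val
          · exact continuous_snd.comp continuous_subtype_val
        continuous_invFun := by
          refine Continuous.subtype_mk (Continuous.prodMk ?_ ?_) _
          · exact continuous_fst.comp continuous_subtype_val
          · exact continuous_subtype_val.comp (continuous_snd.comp continuous_subtype_val) }
    exact h1.comp_homeomorph e
  · intro a ha
    obtain ⟨ha1, ha2⟩ := (hrange a).1 ha
    rw [← hσ.two_sheeted _ ha2]
    refine ncard_congr (fun y _ => y.1.1) ?_ ?_ ?_
    · intro y hy
      have hy' : y.1.2 = a := hy
      rw [mem_preimage, mem_singleton_iff, y.2.2, hy']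
    · intro y y' hy hy' h
      exact Subtype.ext (Prod.ext h (Eq.trans (b := a) hy (Eq.symm hy')))
    · intro e he
      exact ⟨⟨(e, a), ha1, he⟩, rfl, rfl⟩
  · intro i j hij γ hγ h10
    let γ' : C(unitInterval, σ.carrier) :=
      ⟨fun t => (γ t).1.1, continuous_fst.comp (continuous_subtype_val.comp γ.continuous)⟩
    have hp : ∀ t, σ.proj (γ' t) = φ ((σ.pullback (frameBundle S' l) φ).proj (γ t)) :=
      fun t => (γ t).2.2
    -- A closed lift of the rotation loop in the fibre product would have a closed first component,
    -- lifting a full rotation of two distinct frame vectors.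
    refine hσ.nontrivial_on_fibres (ι i) (ι j) (hι.ne hij) γ' (fun t => ?_) ?_
    · rw [hp, hp, hγ, hrot]
    · exact congrArg (fun y => y.1.1) h10

end FrameBundle

/-! ### Spin structures on conormal and unit conormal bundles -/

section Conormal

variable {V : Type} [NormedAddCommGroup V] [InnerProductSpace ℝ V] [FiniteDimensional ℝ V]
  {d k : ℕ} {K : Set V}

theorem IsSphereUnion.isSpinStructure_conormalCover (hK : IsSphereUnion d K)
    (hV : Module.finrank ℝ V = k) {σ : FrameCover.{u} V k} (hσ : IsSpinStructure univ σ) :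
    IsSpinStructure (conormal K) (conormalCover σ K) := by
  refine hσ.pullback (ι := id) ?_ ?_ ?_ Function.injective_id ?_
  · rintro ⟨x, f⟩ ⟨hx, hf, hs⟩
    simp only at hx hf hs
    have h1 : LinearIndependent ℝ fun i => conormalIso K x (f i) := by
      refine hf.map (f := conormalIso K x) ?_
      rw [hs, Submodule.disjoint_def]
      exact fun y hy hy' => hK.conormalIso_injOn hx hy hy'
    refine ⟨trivial, h1, ?_⟩
    rw [tangentSpace_univ]
    exact h1.span_eq_top_of_card_eq_finrank' (by simp [hV])
  · refine ContinuousOn.prodMk (by fun_prop) (continuousOn_pi.2 fun i => ?_)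
    exact hK.continuousOn_conormalIso.comp (f := fun a : (V × V) × (Fin k → V × V) => (a.1, a.2 i))
      (by fun_prop) fun a ha => ha.1.1
  · intro x f g
    exact ⟨g, rfl, by simp only [map_sum, map_smul]⟩
  · intro x f i j θ
    exact Prod.ext rfl (rotateFrame_map (conormalIso K x) i j θ f)

/-- The radial vector is tangent to the conormal bundle, which is invariant under scaling the
covector. It is not tangent to the unit conormal bundle, because the derivative of `‖p‖ ^ 2` along
it is `2`. Independence and the dimension bound then give a frame. -/
theorem IsSphereUnion.cons_mem_frameBundle (hK : IsSphereUnion d K)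
    (hV : Module.finrank ℝ V = k + 1) {x : V × V} {f : Fin k → V × V}
    (h : (x, f) ∈ frameBundle (unitConormal K) k) :
    (x, (Fin.cons (0, x.2) f : Fin (k + 1) → V × V)) ∈ frameBundle (conormal K) (k + 1) := by
  obtain ⟨hx, hf, hs⟩ := h
  simp only at hx hf hs
  have hx1 : ‖x.2‖ = 1 := hx.2
  have hnot : (0, x.2) ∉ Submodule.span ℝ (range f) := by
    rw [hs]
    intro hmem
    have h1 := (hasFDerivAt_snd (𝕜 := ℝ) (p := x)).norm_sq.hasFDerivWithinAt
      (s := unitConormal K)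
    have h2 := hasFDerivWithinAt_apply_eq_zero h1 hx (c := 1)
      (fun y hy => by rw [show ‖y.2‖ = 1 from hy.2]; norm_num) hmem
    simp [hx1] at h2
  have hli : LinearIndependent ℝ (Fin.cons (0, x.2) f : Fin (k + 1) → V × V) :=
    linearIndependent_finCons.2 ⟨hf, hnot⟩
  refine ⟨hx.1, hli, ?_⟩
  apply Submodule.eq_of_le_of_finrank_le
  · rw [Submodule.span_le, Fin.range_cons, insert_subset_iff]
    constructor
    · have h1 : HasDerivAt (fun t : ℝ => (x.1, (1 + t) • x.2)) ((0 : V), x.2) 0 := by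
        refine (hasDerivAt_const _ _).prodMk ?_
        simpa using ((hasDerivAt_id (0 : ℝ)).const_add 1).smul_const x.2
      have h2 := deriv_mem_tangentSpace (S := conormal K) h1 fun t =>
        ⟨hx.1.1, fun v hv => by rw [inner_smul_left, hx.1.2 v hv, mul_zero]⟩
      simpa using h2
    · have h1 : Submodule.span ℝ (range f) ≤ tangentSpace (conormal K) x :=
        hs.trans_le (tangentSpace_mono inter_subset_left x)
      exact Submodule.span_le.1 h1
  · rw [finrank_span_eq_card hli, Fintype.card_fin]
    exact (hK.finrank_tangentSpace_conormal_le hx.1).trans hV.le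

theorem IsSphereUnion.isSpinStructure_unitConormalCover (hK : IsSphereUnion d K)
    (hV : Module.finrank ℝ V = k + 1) {σ : FrameCover.{u} V (k + 1)}
    (hσ : IsSpinStructure univ σ) :
    IsSpinStructure (unitConormal K) (unitConormalCover σ K) := by
  refine (hK.isSpinStructure_conormalCover hV hσ).pullback (ι := Fin.succ) ?_ ?_ ?_
    (Fin.succ_injective k) ?_
  · rintro ⟨x, f⟩ h
    exact hK.cons_mem_frameBundle hV h
  · refine (Continuous.prodMk (by fun_prop) (continuous_pi fun i => ?_)).continuousOn
    induction i using Fin.cases with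
    | zero => simp only [Fin.cons_zero]; fun_prop
    | succ i => simp only [Fin.cons_succ]; fun_prop
  · intro x f g
    -- Stabilization turns a change of frame `g` into the block matrix of `1` and `g`, with the same
    -- determinant.
    refine ⟨Matrix.of (Fin.cons (Fin.cons 1 0) fun i => Fin.cons 0 (g i)), ?_, ?_⟩
    · rw [Matrix.det_succ_row_zero, Fin.sum_univ_succ]
      simp [Matrix.submatrix]
      rfl
    · refine Prod.ext rfl (funext fun j => ?_)
      induction j using Fin.cases with
      | zero => simp [Fin.sum_univ_succ]
      | succ j => simp [Fin.sum_univ_succ]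
  · intro x f i j θ
    exact Prod.ext rfl (rotateFrame_cons (0, x.2) i j θ f)

end Conormal

/-! ### Lifting motions to a spin structure -/

/-- An isotopy of the base of a covering lifts to the total space. -/
theorem exists_homeomorph_lift {E X : Type*} [TopologicalSpace E] [TopologicalSpace X] {p : E → X}
    (hp : IsCoveringMap p) (H H' : C(unitInterval × X, X)) (h0 : ∀ x, H (0, x) = x)
    (hl : ∀ s x, H' (s, H (s, x)) = x) (hr : ∀ s x, H (s, H' (s, x)) = x) :
    ∃ Θ : E ≃ₜ E, ∀ y, p (Θ y) = H (1, p y) := by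
  have h0' : ∀ x, H' (0, x) = x := fun x => by rw [← h0 (H' (0, x)), hr]
  let P : C(unitInterval × E, unitInterval × X) :=
    (ContinuousMap.id _).prodMap ⟨p, hp.continuous⟩
  let L := hp.liftHomotopy (H.comp P) (ContinuousMap.id E) fun y => h0 (p y)
  let L' := hp.liftHomotopy (H'.comp P) (ContinuousMap.id E) fun y => h0' (p y)
  have hL : ∀ s y, p (L (s, y)) = H (s, p y) := fun s y =>
    congrFun (hp.liftHomotopy_lifts (H.comp P) (ContinuousMap.id E) fun y => h0 (p y)) (s, y)
  have hL' : ∀ s y, p (L' (s, y)) = H' (s, p y) := fun s y =>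
    congrFun (hp.liftHomotopy_lifts (H'.comp P) (ContinuousMap.id E) fun y => h0' (p y)) (s, y)
  have hL0 : ∀ y, L (0, y) = y := fun y => hp.liftHomotopy_zero _ _ _ y
  have hL0' : ∀ y, L' (0, y) = y := fun y => hp.liftHomotopy_zero _ _ _ y
  -- For fixed `y` the path `s ↦ L' (s, L (s, y))` lies over a constant path, so it is constant by
  -- discreteness of the fibres.
  have key : ∀ y, L' (1, L (1, y)) = y := fun y => by
    have h := hp.const_of_comp (A := unitInterval) (g := fun s => L' (s, L (s, y))) (by fun_prop)
      (fun s s' => by rw [hL', hL', hL, hL, hl, hl]) 1 0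
    rwa [hL0, hL0'] at h
  have key' : ∀ y, L (1, L' (1, y)) = y := fun y => by
    have h := hp.const_of_comp (A := unitInterval) (g := fun s => L (s, L' (s, y))) (by fun_prop)
      (fun s s' => by rw [hL, hL, hL', hL', hr, hr]) 1 0
    rwa [hL0', hL0] at h
  exact ⟨⟨⟨fun y => L (1, y), fun y => L' (1, y), key, key'⟩, by fun_prop, by fun_prop⟩,
    fun y => hL 1 y⟩

section Frames

variable {V W : Type} [NormedAddCommGroup V] [NormedSpace ℝ V]
  [NormedAddCommGroup W] [NormedSpace ℝ W]

theorem map_mem_frameBundle {k : ℕ} {S : Set V} {T : Set W} {x : V} {f : Fin k → V}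
    (h : (x, f) ∈ frameBundle S k) {y : W} (hy : y ∈ T) (L : V ≃L[ℝ] W)
    (hL : tangentSpace T y = (tangentSpace S x).map (L : V →ₗ[ℝ] W)) :
    (y, fun i => L (f i)) ∈ frameBundle T k := by
  obtain ⟨hx, hf, hs⟩ := h
  simp only at hx hf hs
  refine ⟨hy, hf.map' (L : V →ₗ[ℝ] W) (LinearMap.ker_eq_bot.2 L.injective), ?_⟩
  rw [hL, ← hs, Submodule.map_span, ← range_comp]
  rfl

/-- The positive frames are clopen: they are open by assumption, and reversing the first vector
identifies their complement with the preimage of an open set. A path therefore cannot change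
orientation class. -/
theorem IsSpinStructure.mem_range_of_path {k : ℕ} {S : Set V} {σ : FrameCover.{u} V (k + 1)}
    (hσ : IsSpinStructure S σ) {c : unitInterval → V × (Fin (k + 1) → V)} (hc : Continuous c)
    (hcm : ∀ s, c s ∈ frameBundle S (k + 1)) (h0 : c 0 ∈ range σ.proj) (s : unitInterval) :
    c s ∈ range σ.proj := by
  let g : Matrix (Fin (k + 1)) (Fin (k + 1)) ℝ :=
    Matrix.diagonal (Fin.cons (-1) fun _ => 1)
  have hg : g.det = -1 := by simp [g, Fin.prod_univ_succ]
  have hg0 : g.det ≠ 0 := by rw [hg]; norm_num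
  let O : Set (frameBundle S (k + 1)) := {a | (a : V × (Fin (k + 1) → V)) ∈ range σ.proj}
  have hO : IsOpen O := hσ.isOpen_positive
  let flip : frameBundle S (k + 1) → frameBundle S (k + 1) := fun a =>
    ⟨(a.1.1, fun j => ∑ i, g i j • a.1.2 i), frame_sum_mem_frameBundle a.2 hg0⟩
  have hflip : Continuous flip := by
    refine Continuous.subtype_mk ?_ _
    fun_prop
  have hcompl : Oᶜ = flip ⁻¹' O := by
    ext a
    have h1 := hσ.orientation a.1.1 a.1.2 g a.2 hg0
    rw [hg] at h1
    change a.1 ∉ range σ.proj ↔ (a.1.1, fun j => ∑ i, g i j • a.1.2 i) ∈ range σ.proj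
    rw [h1]
    have h2 : ¬ (0 : ℝ) < -1 := by norm_num
    simp only [h2, iff_false]
  have hclopen : IsClopen O := ⟨⟨hcompl ▸ hO.preimage hflip⟩, hO⟩
  have hC : Continuous fun s => (⟨c s, hcm s⟩ : frameBundle S (k + 1)) := hc.subtype_mk hcm
  have h1 := (hclopen.preimage hC).eq_univ ⟨0, h0⟩
  have h2 : s ∈ (fun s => (⟨c s, hcm s⟩ : frameBundle S (k + 1))) ⁻¹' O := by rw [h1]; trivial
  exact h2

end Frames

section Rigid

variable {V : Type} [NormedAddCommGroup V] [InnerProductSpace ℝ V]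

theorem rigid_symm_rigid (A : V ≃ₗᵢ[ℝ] V) (t q : V) :
    rigid A.symm (-A.symm t) (rigid A t q) = q := by
  simp [rigid]

theorem rigid_rigid_symm (A : V ≃ₗᵢ[ℝ] V) (t q : V) :
    rigid A t (rigid A.symm (-A.symm t) q) = q := by
  simp [rigid]

/-- A rigid motion that can be joined to the identity by rigid motions lifts to a spin structure
on Euclidean space. -/
theorem IsSpinStructure.exists_rigid_lift {k : ℕ} {σ : FrameCover.{u} V (k + 1)}
    (hσ : IsSpinStructure (univ : Set V) σ) (A : ℝ → V ≃ₗᵢ[ℝ] V) (t : ℝ → V)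
    (hA : Continuous fun x : ℝ × V => A x.1 x.2)
    (hA' : Continuous fun x : ℝ × V => (A x.1).symm x.2) (ht : Continuous t)
    (hA0 : ∀ v, A 0 v = v) (ht0 : t 0 = 0) :
    ∃ Θ : σ.carrier ≃ₜ σ.carrier, ∀ y, σ.proj (Θ y) =
      (rigid (A 1) (t 1) (σ.proj y).1, fun i => A 1 ((σ.proj y).2 i)) := by
  have hA0' : ∀ v, (A 0).symm v = v := fun v => (A 0).symm_apply_eq.2 (hA0 v).symm
  have hframe : ∀ (B : V ≃ₗᵢ[ℝ] V) (q q' : V) (f : Fin (k + 1) → V),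
      (q, f) ∈ frameBundle (univ : Set V) (k + 1) →
      (q', fun i => B (f i)) ∈ frameBundle (univ : Set V) (k + 1) := fun B q q' f h =>
    map_mem_frameBundle h (mem_univ _) B.toContinuousLinearEquiv (by
      rw [tangentSpace_univ, tangentSpace_univ, Submodule.map_top]
      exact (LinearMap.range_eq_top.2 B.surjective).symm)
  let X := range σ.proj
  have hX : ∀ x : X, x.1 ∈ frameBundle (univ : Set V) (k + 1) := by
    rintro ⟨_, y, rfl⟩; exact hσ.proj_mem y
  have hc : Continuous fun z : unitInterval × X => (rigid (A z.1) (t z.1) z.2.1.1,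
      fun i => A z.1 (z.2.1.2 i)) := by
    refine Continuous.prodMk ?_ (continuous_pi fun i => ?_)
    · exact (hA.comp (f := fun z : unitInterval × X => ((z.1 : ℝ), z.2.1.1))
        (by fun_prop)).add (by fun_prop)
    · exact hA.comp (f := fun z : unitInterval × X => ((z.1 : ℝ), z.2.1.2 i)) (by fun_prop)
  have hc' : Continuous fun z : unitInterval × X =>
      (rigid (A z.1).symm (-(A z.1).symm (t z.1)) z.2.1.1, fun i => (A z.1).symm (z.2.1.2 i)) := by
    refine Continuous.prodMk ?_ (continuous_pi fun i => ?_)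
    · exact (hA'.comp (f := fun z : unitInterval × X => ((z.1 : ℝ), z.2.1.1))
        (by fun_prop)).add (hA'.comp (f := fun z : unitInterval × X => ((z.1 : ℝ), t z.1))
        (by fun_prop)).neg
    · exact hA'.comp (f := fun z : unitInterval × X => ((z.1 : ℝ), z.2.1.2 i)) (by fun_prop)
  -- The path of motions acts on positive frames, since it starts at the identity and cannot leave
  -- their clopen set; `H'` is the pointwise inverse path.
  let H : C(unitInterval × X, X) := ⟨fun z => ⟨_, hσ.mem_range_of_path
    (hc.comp (Continuous.prodMk continuous_id (continuous_const (y := z.2))))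
    (fun s => hframe _ _ _ _ (hX z.2)) (by simp [rigid, hA0, ht0]) z.1⟩, hc.subtype_mk _⟩
  let H' : C(unitInterval × X, X) := ⟨fun z => ⟨_, hσ.mem_range_of_path
    (hc'.comp (Continuous.prodMk continuous_id (continuous_const (y := z.2))))
    (fun s => hframe _ _ _ _ (hX z.2)) (by simp [rigid, hA0', ht0]) z.1⟩, hc'.subtype_mk _⟩
  obtain ⟨Θ, hΘ⟩ := exists_homeomorph_lift hσ.isCoveringMap H H'
    (fun x => Subtype.ext (Prod.ext (by simp [H, rigid, hA0, ht0]) (by simp [H, hA0])))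
    (fun s x => Subtype.ext (Prod.ext (rigid_symm_rigid _ _ _) (by simp [H, H'])))
    (fun s x => Subtype.ext (Prod.ext (rigid_rigid_symm _ _ _) (by simp [H, H'])))
  refine ⟨Θ, fun y => ?_⟩
  have h := congrArg Subtype.val (hΘ y)
  simpa [H, rangeFactorization] using h

end Rigid

/-! ### Moving one component by a rigid motion -/

section Move

variable {V : Type} [NormedAddCommGroup V] [InnerProductSpace ℝ V]

open Classical in
/-- Apply the rigid motion `(A, t)` to the frames over `P`, and leave the others in place. -/
noncomputable def moveFrame {k : ℕ} (P : Set V) (A : V ≃ₗᵢ[ℝ] V) (t : V)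
    (a : (V × V) × (Fin k → V × V)) : (V × V) × (Fin k → V × V) :=
  if a.1.1 ∈ P then (cotangentRigid A t a.1, fun i => cotangentLin A (a.2 i)) else a

/-- The linear part carries the radial vector at a point to the radial vector at its image, so
moving frames commutes with stabilization. -/
theorem moveFrame_cons {k : ℕ} (P : Set V) (A : V ≃ₗᵢ[ℝ] V) (t : V)
    (a : (V × V) × (Fin k → V × V)) :
    moveFrame P A t (a.1, (Fin.cons (0, a.1.2) a.2 : Fin (k + 1) → V × V)) =
      ((moveFrame P A t a).1, (Fin.cons (0, (moveFrame P A t a).1.2) (moveFrame P A t a).2 :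
        Fin (k + 1) → V × V)) := by
  by_cases h : a.1.1 ∈ P
  · simp only [moveFrame, h, if_true]
    refine Prod.ext rfl (funext fun i => ?_)
    induction i using Fin.cases with
    | zero => simp [cotangentRigid]
    | succ i => simp
  · simp only [moveFrame, h, if_false]

theorem moveFrame_symm {k : ℕ} {P Q : Set V} {A : V ≃ₗᵢ[ℝ] V} {t : V}
    (hQ : Disjoint Q (rigid A t '' P)) {a : (V × V) × (Fin k → V × V)} (ha : a.1.1 ∈ Q ∪ P) :
    moveFrame (rigid A t '' P) A.symm (-A.symm t) (moveFrame P A t a) = a := by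
  by_cases h : a.1.1 ∈ P
  · have h' : A a.1.1 + t ∈ rigid A t '' P := ⟨_, h, rfl⟩
    simp [moveFrame, h, cotangentRigid, h']
  · have h' := disjoint_left.1 hQ (ha.resolve_right h)
    simp [moveFrame, h, h']

variable {Q P : Set V} {A : V ≃ₗᵢ[ℝ] V} {t : V}

theorem isClosed_rigid_image (A : V ≃ₗᵢ[ℝ] V) (t : V) (hP : IsClosed P) :
    IsClosed (rigid A t '' P) :=
  (A.toHomeomorph.trans (Homeomorph.addRight t)).isClosedMap P hP

theorem moveFrame_mem_frameBundle_unitConormal {k : ℕ} (hQ : IsClosed Q) (hP : IsClosed P)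
    (hd : Disjoint Q P) (hd' : Disjoint Q (rigid A t '' P)) {a : (V × V) × (Fin k → V × V)}
    (ha : a ∈ frameBundle (unitConormal (Q ∪ P)) k) :
    moveFrame P A t a ∈ frameBundle (unitConormal (Q ∪ rigid A t '' P)) k := by
  by_cases h : a.1.1 ∈ P
  · simp only [moveFrame, h, if_true]
    have h1 := eventually_mem_unitConormal_iff (x := a.1) (eventually_mem_union_iff_right hQ hd h)
    have h2 := eventually_mem_unitConormal_iff (x := cotangentRigid A t a.1)
      (eventually_mem_union_iff_right (P := rigid A t '' P) hQ hd' ⟨_, h, rfl⟩)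
    refine map_mem_frameBundle ha (h2.self_of_nhds.2 ?_) (cotangentLin A) ?_
    · rw [cotangentRigid_mem_unitConormal_iff]; exact h1.self_of_nhds.1 ha.1
    · rw [tangentSpace_congr h2, tangentSpace_congr h1, unitConormal_rigid,
        tangentSpace_cotangentRigid]
  · simp only [moveFrame, h, if_false]
    have hq := ha.1.1.1.resolve_right h
    have h1 := eventually_mem_unitConormal_iff (x := a.1) (eventually_mem_union_iff_left hP hd hq)
    have h2 := eventually_mem_unitConormal_iff (x := a.1)
      (eventually_mem_union_iff_left (isClosed_rigid_image A t hP) hd' hq)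
    refine ⟨h2.self_of_nhds.2 (h1.self_of_nhds.1 ha.1), ha.2.1, ?_⟩
    rw [tangentSpace_congr h2, ← tangentSpace_congr h1, ha.2.2]

theorem moveFrame_mem_frameBundle_conormal {k : ℕ} (hQ : IsClosed Q) (hP : IsClosed P)
    (hd : Disjoint Q P) (hd' : Disjoint Q (rigid A t '' P)) {a : (V × V) × (Fin k → V × V)}
    (ha : a ∈ frameBundle (conormal (Q ∪ P)) k) :
    moveFrame P A t a ∈ frameBundle (conormal (Q ∪ rigid A t '' P)) k := by
  by_cases h : a.1.1 ∈ P
  · simp only [moveFrame, h, if_true]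
    have h1 := eventually_mem_conormal_iff (x := a.1) (eventually_mem_union_iff_right hQ hd h)
    have h2 := eventually_mem_conormal_iff (x := cotangentRigid A t a.1)
      (eventually_mem_union_iff_right (P := rigid A t '' P) hQ hd' ⟨_, h, rfl⟩)
    refine map_mem_frameBundle ha (h2.self_of_nhds.2 ?_) (cotangentLin A) ?_
    · rw [cotangentRigid_mem_conormal_iff]; exact h1.self_of_nhds.1 ha.1
    · rw [tangentSpace_congr h2, tangentSpace_congr h1, conormal_rigid,
        tangentSpace_cotangentRigid]
  · simp only [moveFrame, h, if_false]
    have hq := ha.1.1.resolve_right h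
    have h1 := eventually_mem_conormal_iff (x := a.1) (eventually_mem_union_iff_left hP hd hq)
    have h2 := eventually_mem_conormal_iff (x := a.1)
      (eventually_mem_union_iff_left (isClosed_rigid_image A t hP) hd' hq)
    refine ⟨h2.self_of_nhds.2 (h1.self_of_nhds.1 ha.1), ha.2.1, ?_⟩
    rw [tangentSpace_congr h2, ← tangentSpace_congr h1, ha.2.2]

open Classical in
-- Locality reduces the comparison to one component at a time. Over `P` it is naturality under the
-- rigid motion, over `Q` nothing changes.
theorem conormalIso_moveFrame [FiniteDimensional ℝ V] {k : ℕ} (hQ : IsClosed Q) (hP : IsClosed P)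
    (hd : Disjoint Q P) (hd' : Disjoint Q (rigid A t '' P)) {a : (V × V) × (Fin k → V × V)}
    (ha : a.1.1 ∈ Q ∪ P) :
    (((moveFrame P A t a).1.1, fun i => conormalIso (Q ∪ rigid A t '' P) (moveFrame P A t a).1
        ((moveFrame P A t a).2 i)) : V × (Fin k → V)) =
      if a.1.1 ∈ P then (rigid A t a.1.1, fun i => A (conormalIso (Q ∪ P) a.1 (a.2 i)))
      else (a.1.1, fun i => conormalIso (Q ∪ P) a.1 (a.2 i)) := by
  by_cases h : a.1.1 ∈ P
  · simp only [moveFrame, h, if_true]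
    refine Prod.ext rfl (funext fun i => ?_)
    simp only
    rw [conormalIso_congr (x := cotangentRigid A t a.1)
      (eventually_mem_union_iff_right (P := rigid A t '' P) hQ hd' ⟨_, h, rfl⟩),
      conormalIso_rigid, conormalIso_congr (eventually_mem_union_iff_right hQ hd h)]
  · simp only [moveFrame, h, if_false]
    have hq := ha.resolve_right h
    rw [conormalIso_congr (x := a.1)
      (eventually_mem_union_iff_left (isClosed_rigid_image A t hP) hd' hq),
      conormalIso_congr (eventually_mem_union_iff_left hP hd hq)]

open Classical in
-- A point of the iterated pullback consists of a tangent frame, its stabilization and a point of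
-- `σ`. Over `P` the frames move by the rigid motion and the point by `Θ`; over `Q` all are kept.
-- The compatibility of `Θ` with frames is what keeps the result in the fibre product.
theorem exists_moveCover [FiniteDimensional ℝ V] {k : ℕ} {σ : FrameCover.{u} V (k + 1)}
    (hQ : IsClosed Q) (hP : IsClosed P) (hd : Disjoint Q P) (hd' : Disjoint Q (rigid A t '' P))
    {Θ : σ.carrier → σ.carrier} (hΘc : Continuous Θ)
    (hΘ : ∀ y, σ.proj (Θ y) = (rigid A t (σ.proj y).1, fun i => A ((σ.proj y).2 i))) :
    ∃ M : (unitConormalCover σ (Q ∪ P)).carrier →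
        (unitConormalCover σ (Q ∪ rigid A t '' P)).carrier, Continuous M ∧
      ∀ y, (M y).1.2 = moveFrame P A t y.1.2 ∧
        (M y).1.1.1.1 = if y.1.2.1.1 ∈ P then Θ y.1.1.1.1 else y.1.1.1.1 := by
  have hbase : ∀ y : (unitConormalCover σ (Q ∪ P)).carrier,
      y.1.1.1.2 = (y.1.2.1, (Fin.cons (0, y.1.2.1.2) y.1.2.2 : Fin (k + 1) → V × V)) :=
    fun y => y.2.2
  have hmemK : ∀ y : (unitConormalCover σ (Q ∪ P)).carrier, y.1.2.1.1 ∈ Q ∪ P :=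
    fun y => y.2.1.1.1.1
  have hmem : ∀ y : (unitConormalCover σ (Q ∪ P)).carrier,
      σ.proj (if y.1.2.1.1 ∈ P then Θ y.1.1.1.1 else y.1.1.1.1) =
        ((moveFrame P A t y.1.1.1.2).1.1, fun i => conormalIso (Q ∪ rigid A t '' P)
          (moveFrame P A t y.1.1.1.2).1 ((moveFrame P A t y.1.1.1.2).2 i)) := by
    intro y
    have h1 : σ.proj y.1.1.1.1 = (y.1.1.1.2.1.1,
      fun i => conormalIso (Q ∪ P) y.1.1.1.2.1 (y.1.1.1.2.2 i)) := y.1.1.2.2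
    have h2 : y.1.1.1.2.1 = y.1.2.1 := by rw [hbase y]
    rw [conormalIso_moveFrame hQ hP hd hd' (by rw [h2]; exact hmemK y), h2]
    by_cases h : y.1.2.1.1 ∈ P
    · simp only [h, if_true, hΘ, h1, h2]
    · simp only [h, if_false, h1, h2]
  refine ⟨fun y => ⟨(⟨(if y.1.2.1.1 ∈ P then Θ y.1.1.1.1 else y.1.1.1.1,
    moveFrame P A t y.1.1.1.2), ?_, hmem y⟩, moveFrame P A t y.1.2), ?_, ?_⟩, ?_,
      fun y => ⟨rfl, rfl⟩⟩
  · exact moveFrame_mem_frameBundle_conormal hQ hP hd hd' y.1.1.2.1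
  · exact moveFrame_mem_frameBundle_unitConormal hQ hP hd hd' y.2.1
  · exact (congrArg (moveFrame P A t) (hbase y)).trans (moveFrame_cons P A t y.1.2)
  · have c1 : Continuous fun y : (unitConormalCover σ (Q ∪ P)).carrier => y.1 :=
      continuous_subtype_val
    have c2 : Continuous fun y : (unitConormalCover σ (Q ∪ P)).carrier => y.1.1.1 :=
      continuous_subtype_val.comp (continuous_fst.comp c1)
    have c3 : Continuous fun y : (unitConormalCover σ (Q ∪ P)).carrier => y.1.2 :=
      continuous_snd.comp c1
    have c4 : Continuous fun y : (unitConormalCover σ (Q ∪ P)).carrier => y.1.1.1.1 :=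
      continuous_fst.comp c2
    have c5 : Continuous fun y : (unitConormalCover σ (Q ∪ P)).carrier => y.1.1.1.2 :=
      continuous_snd.comp c2
    have hAc : Continuous A := A.continuous
    refine Continuous.subtype_mk (Continuous.prodMk (Continuous.subtype_mk (Continuous.prodMk
      ?_ ?_) _) ?_) _
    · exact continuous_ite_mem hQ hP hd (by fun_prop) hmemK (hΘc.comp c4) c4
    · refine continuous_ite_mem hQ hP hd (π := fun y => y.1.1.1.2.1.1) (by fun_prop)
        (fun y => by rw [hbase y]; exact hmemK y) ?_ c5
      simp only [cotangentRigid, cotangentLin_apply]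
      fun_prop
    · refine continuous_ite_mem hQ hP hd (π := fun y => y.1.2.1.1) (by fun_prop) hmemK ?_ c3
      simp only [cotangentRigid, cotangentLin_apply]
      fun_prop

theorem unitConormalCover_ext [FiniteDimensional ℝ V] {k : ℕ} {σ : FrameCover.{u} V (k + 1)}
    {K : Set V} {y y' : (unitConormalCover σ K).carrier} (h : y.1.2 = y'.1.2)
    (h' : y.1.1.1.1 = y'.1.1.1.1) : y = y' := by
  refine Subtype.ext (Prod.ext (Subtype.ext (Prod.ext h' ?_)) h)
  have h1 : y.1.1.1.2 = (y.1.2.1, (Fin.cons (0, y.1.2.1.2) y.1.2.2 : Fin (k + 1) → V × V)) :=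
    y.2.2
  have h2 : y'.1.1.1.2 =
    (y'.1.2.1, (Fin.cons (0, y'.1.2.1.2) y'.1.2.2 : Fin (k + 1) → V × V)) := y'.2.2
  rw [h1, h2, h]

theorem rigid_symm_image (A : V ≃ₗᵢ[ℝ] V) (t : V) (P : Set V) :
    rigid A.symm (-A.symm t) '' (rigid A t '' P) = P := by
  rw [← image_comp, show rigid A.symm (-A.symm t) ∘ rigid A t = id from
    funext (rigid_symm_rigid A t), image_id]

/-- The spin structures of the unit conormal bundles of `Q ∪ P` and `Q ∪ ρ(P)`, for a rigid motion
`ρ` that is covered by an automorphism of the spin structure, are isomorphic. -/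
theorem exists_homeomorph_moveFrame [FiniteDimensional ℝ V] {k : ℕ}
    {σ : FrameCover.{u} V (k + 1)} (hQ : IsClosed Q) (hP : IsClosed P) (hd : Disjoint Q P)
    (hd' : Disjoint Q (rigid A t '' P)) (Θ : σ.carrier ≃ₜ σ.carrier)
    (hΘ : ∀ y, σ.proj (Θ y) = (rigid A t (σ.proj y).1, fun i => A ((σ.proj y).2 i))) :
    ∃ Φ : (unitConormalCover σ (Q ∪ P)).carrier ≃ₜ
        (unitConormalCover σ (Q ∪ rigid A t '' P)).carrier,
      ∀ y, (unitConormalCover σ (Q ∪ rigid A t '' P)).proj (Φ y) =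
        moveFrame P A t ((unitConormalCover σ (Q ∪ P)).proj y) := by
  have hΘ' : ∀ y, σ.proj (Θ.symm y) =
      (rigid A.symm (-A.symm t) (σ.proj y).1, fun i => A.symm ((σ.proj y).2 i)) := fun y => by
    have h := hΘ (Θ.symm y)
    rw [Θ.apply_symm_apply] at h
    rw [h]
    refine Prod.ext (rigid_symm_rigid A t _).symm ?_
    simp
  have hPc := isClosed_rigid_image A t hP
  obtain ⟨M, hM, hM'⟩ := exists_moveCover hQ hP hd hd' Θ.continuous hΘ
  obtain ⟨N, hN, hN'⟩ := exists_moveCover (A := A.symm) (t := -A.symm t) hQ hPc hd'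
    (by rwa [rigid_symm_image]) Θ.symm.continuous hΘ'
  -- The target of `N` mentions the double image of `P`. Abstracting that set allows it to be
  -- replaced by `P` in the dependent types.
  generalize hPe : rigid A.symm (-A.symm t) '' (rigid A t '' P) = P' at N hN hN'
  have hPP : P' = P := by rw [← hPe, rigid_symm_image]
  subst hPP
  refine ⟨⟨⟨M, N, fun y => ?_, fun y => ?_⟩, hM, hN⟩, fun y => (hM' y).1⟩
  · have hy : y.1.2.1.1 ∈ Q ∪ P' := y.2.1.1.1.1
    apply unitConormalCover_ext
    · rw [(hN' _).1, (hM' _).1, moveFrame_symm hd' hy]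
    · rw [(hN' _).2, (hM' _).2, (hM' _).1]
      by_cases h : y.1.2.1.1 ∈ P'
      · have h' : A y.1.2.1.1 + t ∈ rigid A t '' P' := ⟨_, h, rfl⟩
        simp [moveFrame, h, cotangentRigid, h']
      · have h' := disjoint_left.1 hd' (hy.resolve_right h)
        simp [moveFrame, h, h']
  · have hy : y.1.2.1.1 ∈ Q ∪ rigid A t '' P' := y.2.1.1.1.1
    apply unitConormalCover_ext
    · rw [(hM' _).1, (hN' _).1]
      have h1 := moveFrame_symm (A := A.symm) (t := -A.symm t) (P := rigid A t '' P')
        (by rwa [hPe]) hy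
      rwa [hPe, A.symm_symm, show -A (-A.symm t) = t by simp] at h1
    · rw [(hM' _).2, (hN' _).2, (hN' _).1]
      by_cases h : y.1.2.1.1 ∈ rigid A t '' P'
      · have h' : A.symm y.1.2.1.1 + -A.symm t ∈ P' :=
          hPe.subset ⟨_, h, rfl⟩
        simp only [moveFrame, h, if_true, cotangentRigid, h', Θ.apply_symm_apply]
      · have h' := disjoint_left.1 hd (hy.resolve_right h)
        simp [moveFrame, h, h']

end Move

/-! ### Gluing smooth embeddings -/

section Glue

variable {V W : Type} [NormedAddCommGroup V] [NormedSpace ℝ V]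
  [NormedAddCommGroup W] [NormedSpace ℝ W]

theorem contDiffOn_union_of_isClosed {f : V → W} {S T : Set V} (hS : IsClosed S) (hT : IsClosed T)
    (hd : Disjoint S T) (hfS : ContDiffOn ℝ ∞ f S) (hfT : ContDiffOn ℝ ∞ f T) :
    ContDiffOn ℝ ∞ f (S ∪ T) := by
  rintro x (hx | hx)
  · refine (hfS x hx).mono_of_mem_nhdsWithin ?_
    filter_upwards [nhdsWithin_le_nhds (eventually_mem_union_iff_left hT hd hx),
      self_mem_nhdsWithin] with y hy hy'
    exact hy.1 hy'
  · refine (hfT x hx).mono_of_mem_nhdsWithin ?_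
    filter_upwards [nhdsWithin_le_nhds (eventually_mem_union_iff_right hS hd hx),
      self_mem_nhdsWithin] with y hy hy'
    exact hy.1 hy'

theorem IsSmoothEmbeddingOn.congr {f f' : V → W} {S : Set V} (hf : IsSmoothEmbeddingOn f S)
    (h : EqOn f' f S) : IsSmoothEmbeddingOn f' S := by
  obtain ⟨h1, g, hg, hl⟩ := hf
  refine ⟨h1.congr h, g, ?_, fun x hx => ?_⟩
  · rwa [h.image_eq]
  · rw [h hx, hl hx]

/-- Compactness makes the two images closed, so the inverses, smooth on disjoint closed sets, glue
to a smooth inverse. -/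
theorem IsSmoothEmbeddingOn.union {f : V → W} {S T : Set V} (hS : IsCompact S) (hT : IsCompact T)
    (hd : Disjoint S T) (hfS : IsSmoothEmbeddingOn f S) (hfT : IsSmoothEmbeddingOn f T)
    (hd' : Disjoint (f '' S) (f '' T)) : IsSmoothEmbeddingOn f (S ∪ T) := by
  classical
  obtain ⟨h1, g, hg, hgl⟩ := hfS
  obtain ⟨h2, g', hg', hgl'⟩ := hfT
  refine ⟨contDiffOn_union_of_isClosed hS.isClosed hT.isClosed hd h1 h2,
    fun y => if y ∈ f '' S then g y else g' y, ?_, ?_⟩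
  · rw [image_union]
    refine contDiffOn_union_of_isClosed (hS.image_of_continuousOn h1.continuousOn).isClosed
      (hT.image_of_continuousOn h2.continuousOn).isClosed hd' ?_ ?_
    · exact hg.congr fun y hy => if_pos hy
    · exact hg'.congr fun y hy => if_neg (disjoint_right.1 hd' hy)
  · rintro x (hx | hx)
    · simp only [mem_image_of_mem f hx, if_true, hgl hx]
    · simp only [disjoint_right.1 hd' (mem_image_of_mem f hx), if_false, hgl' hx]

end Glue

/-! ### From a motion of one component to a spin isotopy -/

section UnitConormal

variable {V : Type} [NormedAddCommGroup V] [InnerProductSpace ℝ V]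

theorem unitConormal_union {Q P : Set V} (hQ : IsClosed Q) (hP : IsClosed P) (hd : Disjoint Q P) :
    unitConormal (Q ∪ P) = unitConormal Q ∪ unitConormal P := by
  have h1 : ∀ x : V × V, x.1 ∈ Q → (x ∈ unitConormal (Q ∪ P) ↔ x ∈ unitConormal Q) := fun x hx =>
    (eventually_mem_unitConormal_iff (eventually_mem_union_iff_left hP hd hx)).self_of_nhds
  have h2 : ∀ x : V × V, x.1 ∈ P → (x ∈ unitConormal (Q ∪ P) ↔ x ∈ unitConormal P) := fun x hx =>
    (eventually_mem_unitConormal_iff (eventually_mem_union_iff_right hQ hd hx)).self_of_nhds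
  ext x
  constructor
  · intro hx
    rcases hx.1.1 with h | h
    · exact Or.inl ((h1 x h).1 hx)
    · exact Or.inr ((h2 x h).1 hx)
  · rintro (hx | hx)
    · exact (h1 x hx.1.1).2 hx
    · exact (h2 x hx.1.1).2 hx

theorem isCompact_unitConormal_roundSphere [FiniteDimensional ℝ V] (c : V) (E : Submodule ℝ V) :
    IsCompact (unitConormal (roundSphere c E)) := by
  have hcl : IsClosed (unitConormal (roundSphere c E)) := by
    have : unitConormal (roundSphere c E) = (Prod.fst ⁻¹' roundSphere c E) ∩
        {x | E.starProjection x.2 = ⟪x.1 - c, x.2⟫_ℝ • (x.1 - c)} ∩ {x | ‖x.2‖ = 1} := by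
      ext x
      rw [unitConormal, mem_inter_iff, mem_conormal_roundSphere]
      rfl
    rw [this]
    exact (((isClosed_roundSphere c E).preimage continuous_fst).inter
      (isClosed_eq (by fun_prop) (by fun_prop))).inter (isClosed_eq (by fun_prop) (by fun_prop))
  refine ((isCompact_closedBall c 1).prod (isCompact_closedBall (0 : V) 1)).of_isClosed_subset hcl
    fun x hx => ⟨?_, ?_⟩
  · rw [mem_closedBall_iff_norm]; exact hx.1.1.2.le
  · rw [mem_closedBall_zero_iff]; exact hx.2.le

variable {Q P : Set V} {A : V ≃ₗᵢ[ℝ] V} {t : V}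

/-- An isotopy of the unit conormal bundle of `P`, in the complement of the unit conormal bundle
of `Q`, whose end is induced by a rigid motion that lifts to the spin structure. -/
theorem spinIsotopic_of_motion [FiniteDimensional ℝ V] {k : ℕ} {σ : FrameCover.{u} V (k + 1)}
    (hQ : IsClosed Q) (hP : IsClosed P) (hd : Disjoint Q P) (hd' : Disjoint Q (rigid A t '' P))
    (hQc : IsCompact (unitConormal Q)) (hPc : IsCompact (unitConormal P))
    (Θ : σ.carrier ≃ₜ σ.carrier)
    (hΘ : ∀ y, σ.proj (Θ y) = (rigid A t (σ.proj y).1, fun i => A ((σ.proj y).2 i)))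
    (m : ℝ → V × V → V × V)
    (hm : ContDiffOn ℝ ∞ (Function.uncurry m) (Icc (0 : ℝ) 1 ×ˢ unitConormal P))
    (hme : ∀ s ∈ Icc (0 : ℝ) 1, IsSmoothEmbeddingOn (m s) (unitConormal P))
    (hmu : ∀ s ∈ Icc (0 : ℝ) 1, MapsTo (m s) (unitConormal P) (unitCotangent V))
    (hmd : ∀ s ∈ Icc (0 : ℝ) 1, ∀ x ∈ unitConormal P, m s x ∉ unitConormal Q)
    (hm0 : ∀ x ∈ unitConormal P, m 0 x = x)
    (hm1 : ∀ x ∈ unitConormal P, m 1 x = cotangentRigid A t x) :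
    SpinIsotopic (unitCotangent V) (unitConormal (Q ∪ P)) (unitConormal (Q ∪ rigid A t '' P))
      (unitConormalCover σ (Q ∪ P)) (unitConormalCover σ (Q ∪ rigid A t '' P)) := by
  classical
  let F : ℝ → V × V → V × V := fun s x => if x.1 ∈ P then m s x else x
  have hFP : ∀ s, EqOn (F s) (m s) (unitConormal P) := fun s x hx => if_pos hx.1.1
  have hFQ : ∀ s, EqOn (F s) id (unitConormal Q) := fun s x hx =>
    if_neg (disjoint_left.1 hd hx.1.1)
  have hdΛ : Disjoint (unitConormal Q) (unitConormal P) :=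
    disjoint_left.2 fun x hx hx' => disjoint_left.1 hd hx.1.1 hx'.1.1
  have hU := unitConormal_union hQ hP hd
  obtain ⟨Φ, hΦ⟩ := exists_homeomorph_moveFrame hQ hP hd hd' Θ hΘ
  refine ⟨F, ?_, fun s hs => ⟨?_, ?_⟩, ?_, ?_, Φ, fun y => ?_⟩
  · rw [hU, prod_union]
    refine contDiffOn_union_of_isClosed (isClosed_Icc.prod hQc.isClosed)
      (isClosed_Icc.prod hPc.isClosed) ?_ ?_ ?_
    · exact disjoint_left.2 fun x hx hx' => disjoint_left.1 hdΛ hx.2 hx'.2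
    · exact contDiff_snd.contDiffOn.congr fun x hx => hFQ x.1 hx.2
    · exact hm.congr fun x hx => hFP x.1 hx.2
  · rw [hU]
    refine IsSmoothEmbeddingOn.union hQc hPc hdΛ ?_ ((hme s hs).congr (hFP s)) ?_
    · exact IsSmoothEmbeddingOn.congr
        ⟨contDiff_id.contDiffOn, id, contDiff_id.contDiffOn, fun _ _ => rfl⟩ (hFQ s)
    · rw [(hFQ s).image_eq, (hFP s).image_eq, image_id]
      refine disjoint_right.2 ?_
      rintro _ ⟨x, hx, rfl⟩
      exact hmd s hs x hx
  · rw [hU]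
    rintro x (hx | hx)
    · rw [hFQ s hx]; exact hx.2
    · rw [hFP s hx]; exact hmu s hs hx
  · rw [hU]
    rintro x (hx | hx)
    · exact hFQ 0 hx
    · rw [hFP 0 hx, hm0 x hx]
  · rw [hU, image_union, (hFQ 1).image_eq, (hFP 1).image_eq, image_id,
      unitConormal_union hQ (isClosed_rigid_image A t hP) hd', unitConormal_rigid]
    congr 1
    exact image_congr hm1
  -- Near each point the final map agrees, on the submanifold, with the rigid motion or with the
  -- identity. Its derivative on tangent vectors is therefore the linear part used in `moveFrame`.
  · rw [hΦ]
    set a := (unitConormalCover σ (Q ∪ P)).proj y with ha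
    have haf : a ∈ frameBundle (unitConormal (Q ∪ P)) k := y.2.1
    have hat : ∀ i, a.2 i ∈ tangentSpace (unitConormal (Q ∪ P)) a.1 := fun i => by
      rw [← haf.2.2]; exact Submodule.subset_span ⟨i, rfl⟩
    by_cases h : a.1.1 ∈ P
    · have h1 := eventually_mem_unitConormal_iff (x := a.1) (eventually_mem_union_iff_right hQ hd h)
      have hx := h1.self_of_nhds.1 haf.1
      have hder : HasFDerivWithinAt (F 1) (cotangentLin A : V × V →L[ℝ] V × V)
          (unitConormal (Q ∪ P)) a.1 := by
        have h2 : HasFDerivWithinAt (cotangentRigid A t) (cotangentLin A : V × V →L[ℝ] V × V)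
            (unitConormal (Q ∪ P)) a.1 := by
          rw [cotangentRigid_eq]
          exact ((cotangentLin A : V × V →L[ℝ] V × V).hasFDerivAt.add_const _).hasFDerivWithinAt
        refine h2.congr_of_eventuallyEq ?_ ((hFP 1 hx).trans (hm1 _ hx))
        filter_upwards [nhdsWithin_le_nhds h1, self_mem_nhdsWithin] with w hw hw'
        exact (hFP 1 (hw.1 hw')).trans (hm1 _ (hw.1 hw'))
      simp only [moveFrame, h, if_true]
      refine Prod.ext ((hFP 1 hx).trans (hm1 _ hx)).symm (funext fun i => ?_)
      exact (fderivWithin_apply_eq hder (hat i)).symm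
    · have hq := haf.1.1.1.resolve_right h
      have h1 := eventually_mem_unitConormal_iff (x := a.1) (eventually_mem_union_iff_left hP hd hq)
      have hx := h1.self_of_nhds.1 haf.1
      have hder : HasFDerivWithinAt (F 1) (ContinuousLinearMap.id ℝ (V × V))
          (unitConormal (Q ∪ P)) a.1 := by
        refine (hasFDerivWithinAt_id a.1 _).congr_of_eventuallyEq ?_ (hFQ 1 hx)
        filter_upwards [nhdsWithin_le_nhds h1, self_mem_nhdsWithin] with w hw hw'
        exact hFQ 1 (hw.1 hw')
      simp only [moveFrame, h, if_false]
      refine Prod.ext (hFQ 1 hx).symm (funext fun i => ?_)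
      exact (fderivWithin_apply_eq hder (hat i)).symm

end UnitConormal

/-! ### Pushing the unit sphere in a direction -/

section Push

theorem sum_ne_zero_of_norm_lt {V : Type} [NormedAddCommGroup V] {w p : V} (hw : ‖w‖ < 1)
    (hp : ‖p‖ = 1) : p + w ≠ 0 := fun h => by
  rw [eq_neg_of_add_eq_zero_left h, norm_neg] at hp
  exact hw.ne hp

variable {V : Type} [NormedAddCommGroup V] [InnerProductSpace ℝ V]

/-- The map of the unit sphere that pushes each point in the direction `w`. -/
noncomputable def push (w p : V) : V := ‖p + w‖⁻¹ • (p + w)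

/-- The inverse of `push w` for `‖w‖ < 1`. -/
noncomputable def unpush (w p : V) : V :=
  (⟪p, w⟫_ℝ + Real.sqrt (⟪p, w⟫_ℝ ^ 2 + (1 - ‖w‖ ^ 2))) • p - w

variable {w p : V}

theorem norm_push (hw : ‖w‖ < 1) (hp : ‖p‖ = 1) : ‖push w p‖ = 1 := by
  rw [push, norm_smul, norm_inv, norm_norm,
    inv_mul_cancel₀ (norm_ne_zero_iff.2 (sum_ne_zero_of_norm_lt hw hp))]

theorem push_zero (hp : ‖p‖ = 1) : push 0 p = p := by
  simp [push, hp]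

/-- A preimage of a unit vector `q` has the form `r • q - w` with norm one, a quadratic equation for
`r` whose larger root is the factor in `unpush`. For `q = push w p` the norm `‖p + w‖` is a root. -/
theorem unpush_push (hw : ‖w‖ < 1) (hp : ‖p‖ = 1) : unpush w (push w p) = p := by
  have hN : 0 < ‖p + w‖ := norm_pos_iff.2 (sum_ne_zero_of_norm_lt hw hp)
  have hr : ⟪push w p, w⟫_ℝ + Real.sqrt (⟪push w p, w⟫_ℝ ^ 2 + (1 - ‖w‖ ^ 2)) = ‖p + w‖ := by
    have h1 : ‖p + w‖ * ⟪push w p, w⟫_ℝ = ⟪p, w⟫_ℝ + ‖w‖ ^ 2 := by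
      rw [push, inner_smul_left, inner_add_left, real_inner_self_eq_norm_sq]
      simp only [conj_trivial]
      field_simp
    have h2 : ‖p + w‖ ^ 2 = 1 + 2 * ⟪p, w⟫_ℝ + ‖w‖ ^ 2 := by
      rw [norm_add_sq_real, hp]; ring
    set x := ⟪push w p, w⟫_ℝ
    have h3 : x ^ 2 + (1 - ‖w‖ ^ 2) = (‖p + w‖ - x) ^ 2 := by nlinarith
    -- This selects the root: `‖p + w‖ * (‖p + w‖ - x) = 1 + ⟪p, w⟫_ℝ`, which is nonnegative by
    -- Cauchy–Schwarz.
    have h4 : 0 ≤ ‖p + w‖ - x := by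
      have h5 : 0 ≤ ‖p + w‖ * (‖p + w‖ - x) := by
        have h6 : |⟪p, w⟫_ℝ| ≤ ‖p‖ * ‖w‖ := abs_real_inner_le_norm p w
        rw [hp, one_mul] at h6
        nlinarith [neg_abs_le ⟪p, w⟫_ℝ]
      exact nonneg_of_mul_nonneg_right h5 hN
    rw [h3, Real.sqrt_sq h4]
    ring
  rw [unpush, hr, push, smul_smul, mul_inv_cancel₀ hN.ne', one_smul, add_sub_cancel_right]

/-- The radicand is at least `1 - ‖w‖ ^ 2`, hence positive on the whole space. -/
theorem contDiff_unpush (hw : ‖w‖ < 1) : ContDiff ℝ ∞ (unpush w) := by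
  have h1 : ContDiff ℝ ∞ fun p : V => ⟪p, w⟫_ℝ := contDiff_id.inner ℝ contDiff_const
  refine ContDiff.sub (ContDiff.smul (h1.add (ContDiff.sqrt ((h1.pow 2).add contDiff_const)
    fun p => ?_)) contDiff_id) contDiff_const
  have : 0 < 1 - ‖w‖ ^ 2 := by nlinarith [norm_nonneg w]
  positivity

end Push

/-! ### Coordinates and the three spheres -/

section Coordinates

variable {d : ℕ}

/-- The coordinate `z₀`. -/
noncomputable def fstCoord (d : ℕ) : Space d →L[ℝ] EuclideanSpace ℝ (Fin (d - 1)) :=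
  LinearMap.toContinuousLinearMap
    { toFun := fun x => WithLp.toLp 2 fun i => x (Sum.inl i)
      map_add' := fun _ _ => rfl
      map_smul' := fun _ _ => rfl }

/-- The coordinate `z₁`. -/
noncomputable def midCoord (d : ℕ) : Space d →L[ℝ] ℝ :=
  LinearMap.toContinuousLinearMap
    { toFun := fun x => x (Sum.inr (Sum.inl ()))
      map_add' := fun _ _ => rfl
      map_smul' := fun _ _ => rfl }

/-- The coordinate `z₂`. -/
noncomputable def sndCoord (d : ℕ) : Space d →L[ℝ] EuclideanSpace ℝ (Fin (d - 1)) :=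
  LinearMap.toContinuousLinearMap
    { toFun := fun x => WithLp.toLp 2 fun i => x (Sum.inr (Sum.inr i))
      map_add' := fun _ _ => rfl
      map_smul' := fun _ _ => rfl }

@[simp] theorem fstCoord_point (a : EuclideanSpace ℝ (Fin (d - 1))) (b : ℝ)
    (c : EuclideanSpace ℝ (Fin (d - 1))) : fstCoord d (point a b c) = a := rfl

@[simp] theorem midCoord_point (a : EuclideanSpace ℝ (Fin (d - 1))) (b : ℝ)
    (c : EuclideanSpace ℝ (Fin (d - 1))) : midCoord d (point a b c) = b := rfl

@[simp] theorem sndCoord_point (a : EuclideanSpace ℝ (Fin (d - 1))) (b : ℝ)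
    (c : EuclideanSpace ℝ (Fin (d - 1))) : sndCoord d (point a b c) = c := rfl

theorem point_coord (x : Space d) : point (fstCoord d x) (midCoord d x) (sndCoord d x) = x := by
  ext i
  rcases i with i | i | i <;> rfl

theorem space_ext {x y : Space d} (h0 : fstCoord d x = fstCoord d y)
    (h1 : midCoord d x = midCoord d y) (h2 : sndCoord d x = sndCoord d y) : x = y := by
  rw [← point_coord x, ← point_coord y, h0, h1, h2]

theorem norm_sq_space (x : Space d) :
    ‖x‖ ^ 2 = ‖fstCoord d x‖ ^ 2 + midCoord d x ^ 2 + ‖sndCoord d x‖ ^ 2 := by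
  rw [EuclideanSpace.norm_sq_eq, EuclideanSpace.norm_sq_eq, EuclideanSpace.norm_sq_eq,
    Fintype.sum_sum_type, Fintype.sum_sum_type]
  simp only [Finset.univ_unique, Finset.sum_singleton, Real.norm_eq_abs, sq_abs]
  rw [← add_assoc]
  rfl

theorem finrank_space : Module.finrank ℝ (Space d) = (d - 1) + (d - 1) + 1 := by
  simp only [finrank_euclideanSpace, Fintype.card_sum, Fintype.card_fin, Fintype.card_unit]
  omega

theorem finrank_ker_sndCoord :
    Module.finrank ℝ (sndCoord d).toLinearMap.ker = (d - 1) + 1 := by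
  have h1 := (sndCoord d).toLinearMap.finrank_range_add_finrank_ker
  rw [LinearMap.range_eq_top.2 fun c => ⟨point 0 0 c, rfl⟩, finrank_top, finrank_space,
    finrank_euclideanSpace_fin] at h1
  omega

theorem finrank_ker_fstCoord :
    Module.finrank ℝ (fstCoord d).toLinearMap.ker = (d - 1) + 1 := by
  have h1 := (fstCoord d).toLinearMap.finrank_range_add_finrank_ker
  rw [LinearMap.range_eq_top.2 fun c => ⟨point c 0 0, rfl⟩, finrank_top, finrank_space,
    finrank_euclideanSpace_fin] at h1
  omega

theorem K₂_eq_roundSphere (z : EuclideanSpace ℝ (Fin (d - 1))) :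
    K₂ d z = roundSphere (point 0 0 z) (sndCoord d).toLinearMap.ker := by
  ext x
  have hn := norm_sq_space (x - point 0 0 z)
  simp only [map_sub, fstCoord_point, midCoord_point, sndCoord_point, sub_zero] at hn
  simp only [K₂, roundSphere, mem_ofPred_eq, LinearMap.mem_ker, ContinuousLinearMap.coe_coe,
    map_sub, sndCoord_point]
  constructor
  · rintro ⟨a, b, h, rfl⟩
    simp only [fstCoord_point, midCoord_point, sndCoord_point, sub_self, norm_zero] at hn ⊢
    refine ⟨trivial, (sq_eq_sq₀ (norm_nonneg _) zero_le_one).1 ?_⟩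
    rw [hn, h]; norm_num
  · rintro ⟨h1, h2⟩
    refine ⟨fstCoord d x, midCoord d x, ?_, ?_⟩
    · rw [h1, h2, norm_zero] at hn; linarith
    · rw [← sub_eq_zero.1 h1, point_coord]

theorem K₀_eq_roundSphere : K₀ d = roundSphere 0 (sndCoord d).toLinearMap.ker := by
  have h := K₂_eq_roundSphere (d := d) 0
  rwa [show (point 0 0 0 : Space d) = 0 from space_ext rfl rfl rfl] at h

theorem K₁_eq_roundSphere :
    K₁ d = roundSphere (point 0 1 0) (fstCoord d).toLinearMap.ker := by
  ext x
  have hn := norm_sq_space (x - point 0 1 0)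
  simp only [map_sub, fstCoord_point, midCoord_point, sndCoord_point, sub_zero] at hn
  simp only [K₁, roundSphere, mem_ofPred_eq, LinearMap.mem_ker, ContinuousLinearMap.coe_coe,
    map_sub, fstCoord_point, sub_zero]
  constructor
  · rintro ⟨b, c, h, rfl⟩
    simp only [fstCoord_point, midCoord_point, sndCoord_point, norm_zero] at hn ⊢
    refine ⟨trivial, (sq_eq_sq₀ (norm_nonneg _) zero_le_one).1 ?_⟩
    rw [hn, add_sub_cancel_right]
    linarith
  · rintro ⟨h1, h2⟩
    refine ⟨midCoord d x - 1, sndCoord d x, ?_, ?_⟩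
    · rw [h1, h2, norm_zero] at hn; linarith
    · rw [sub_add_cancel, ← h1, point_coord]

end Coordinates

/-! ### Rotations in the outer coordinates -/

section Rotation

variable {d : ℕ}

/-- The projection to the `(z₀, z₂)`-space. -/
noncomputable def outerProj (d : ℕ) : Space d →L[ℝ] Space d :=
  LinearMap.toContinuousLinearMap
    { toFun := fun x => point (fstCoord d x) 0 (sndCoord d x)
      map_add' := fun x y => space_ext (by simp) (by simp) (by simp)
      map_smul' := fun c x => space_ext (by simp) (by simp) (by simp) }

/-- The map `(z₀, z₁, z₂) ↦ (-z₂, 0, z₀)`. -/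
noncomputable def quarterTurn (d : ℕ) : Space d →L[ℝ] Space d :=
  LinearMap.toContinuousLinearMap
    { toFun := fun x => point (-sndCoord d x) 0 (fstCoord d x)
      map_add' := fun x y => space_ext (by simp [add_comm]) (by simp) (by simp)
      map_smul' := fun c x => space_ext (by simp) (by simp) (by simp) }

/-- The rotation by the angle `θ` that moves `z₀` towards `z₂`, as a linear map. -/
noncomputable def rotationAux (θ : ℝ) : Space d →ₗ[ℝ] Space d :=
  (LinearMap.id - (outerProj d : Space d →ₗ[ℝ] Space d)) +
    (Real.cos θ • (outerProj d : Space d →ₗ[ℝ] Space d) +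
      Real.sin θ • (quarterTurn d : Space d →ₗ[ℝ] Space d))

theorem fstCoord_rotationAux (θ : ℝ) (x : Space d) : fstCoord d (rotationAux θ x) =
    Real.cos θ • fstCoord d x - Real.sin θ • sndCoord d x := by
  simp [rotationAux, outerProj, quarterTurn, sub_eq_add_neg]

theorem midCoord_rotationAux (θ : ℝ) (x : Space d) :
    midCoord d (rotationAux θ x) = midCoord d x := by
  simp [rotationAux, outerProj, quarterTurn]

theorem sndCoord_rotationAux (θ : ℝ) (x : Space d) : sndCoord d (rotationAux θ x) =
    Real.sin θ • fstCoord d x + Real.cos θ • sndCoord d x := by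
  simp [rotationAux, outerProj, quarterTurn]
  abel

theorem rotationAux_neg (θ : ℝ) (x : Space d) : rotationAux (-θ) (rotationAux θ x) = x := by
  have h := Real.sin_sq_add_cos_sq θ
  apply space_ext
  · rw [fstCoord_rotationAux, fstCoord_rotationAux, sndCoord_rotationAux, Real.cos_neg,
      Real.sin_neg]
    trans (Real.sin θ ^ 2 + Real.cos θ ^ 2) • fstCoord d x
    · module
    · rw [h, one_smul]
  · rw [midCoord_rotationAux, midCoord_rotationAux]
  · rw [sndCoord_rotationAux, fstCoord_rotationAux, sndCoord_rotationAux, Real.cos_neg,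
      Real.sin_neg]
    trans (Real.sin θ ^ 2 + Real.cos θ ^ 2) • sndCoord d x
    · module
    · rw [h, one_smul]

theorem norm_rotationAux (θ : ℝ) (x : Space d) : ‖rotationAux θ x‖ = ‖x‖ := by
  refine (sq_eq_sq₀ (norm_nonneg _) (norm_nonneg _)).1 ?_
  rw [norm_sq_space, norm_sq_space x, fstCoord_rotationAux, midCoord_rotationAux,
    sndCoord_rotationAux, norm_add_sq_real, norm_sub_sq_real]
  simp only [norm_smul, inner_smul_left, inner_smul_right, mul_pow, Real.norm_eq_abs, sq_abs,
    conj_trivial]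
  have h := Real.sin_sq_add_cos_sq θ
  linear_combination (‖fstCoord d x‖ ^ 2 + ‖sndCoord d x‖ ^ 2) * h

/-- The rotation by the angle `θ` that moves `z₀` towards `z₂` and fixes `z₁`. -/
noncomputable def rotation (θ : ℝ) : Space d ≃ₗᵢ[ℝ] Space d where
  toLinearEquiv := LinearEquiv.ofLinearMap (rotationAux θ) (rotationAux (-θ))
    (LinearMap.ext fun x => by simpa using rotationAux_neg (-θ) x)
    (LinearMap.ext fun x => rotationAux_neg θ x)
  norm_map' := norm_rotationAux θ

theorem rotation_apply (θ : ℝ) (x : Space d) : rotation θ x =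
    (x - outerProj d x) + (Real.cos θ • outerProj d x + Real.sin θ • quarterTurn d x) := rfl

theorem rotation_symm (θ : ℝ) : (rotation θ).symm = (rotation (-θ) : Space d ≃ₗᵢ[ℝ] Space d) := by
  ext1 x
  rfl

theorem fstCoord_rotation (θ : ℝ) (x : Space d) : fstCoord d (rotation θ x) =
    Real.cos θ • fstCoord d x - Real.sin θ • sndCoord d x := fstCoord_rotationAux θ x

theorem midCoord_rotation (θ : ℝ) (x : Space d) :
    midCoord d (rotation θ x) = midCoord d x := midCoord_rotationAux θ x

theorem sndCoord_rotation (θ : ℝ) (x : Space d) : sndCoord d (rotation θ x) =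
    Real.sin θ • fstCoord d x + Real.cos θ • sndCoord d x := sndCoord_rotationAux θ x

theorem contDiff_rotation : ContDiff ℝ ∞ fun y : ℝ × Space d => rotation y.1 y.2 := by
  simp only [rotation_apply]
  have h1 : ContDiff ℝ ∞ fun y : ℝ × Space d => outerProj d y.2 :=
    (outerProj d).contDiff.comp contDiff_snd
  have h2 : ContDiff ℝ ∞ fun y : ℝ × Space d => quarterTurn d y.2 :=
    (quarterTurn d).contDiff.comp contDiff_snd
  exact (contDiff_snd.sub h1).add (((Real.contDiff_cos.comp contDiff_fst).smul h1).add
    ((Real.contDiff_sin.comp contDiff_fst).smul h2))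

theorem rotation_zero (x : Space d) : rotation 0 x = x := by
  simp [rotation_apply]

end Rotation

/-! ### The unlinking isotopy -/

section Link

variable {d : ℕ} {z : EuclideanSpace ℝ (Fin (d - 1))}

theorem inner_space (x y : Space d) : ⟪x, y⟫_ℝ = ⟪fstCoord d x, fstCoord d y⟫_ℝ +
    midCoord d x * midCoord d y + ⟪sndCoord d x, sndCoord d y⟫_ℝ := by
  have h1 := norm_sq_space (x + y)
  simp only [map_add, norm_add_sq_real] at h1
  linarith [norm_sq_space x, norm_sq_space y]

theorem norm_point_snd (z : EuclideanSpace ℝ (Fin (d - 1))) :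
    ‖(point 0 0 z : Space d)‖ = ‖z‖ := by
  refine (sq_eq_sq₀ (norm_nonneg _) (norm_nonneg _)).1 ?_
  simp [norm_sq_space]

theorem disjoint_K₀_K₁ (d : ℕ) : Disjoint (K₀ d) (K₁ d) := by
  rw [disjoint_left]
  rintro _ ⟨a, b, h, rfl⟩ ⟨b', c, h', he⟩
  have h0 : a = 0 := congrArg (fstCoord d) he
  have h1 : b = b' + 1 := congrArg (midCoord d) he
  have h2 : 0 = c := congrArg (sndCoord d) he
  subst h0 h1 h2
  rw [norm_zero] at h h'
  nlinarith

theorem disjoint_K₀_K₂ (hz : z ≠ 0) : Disjoint (K₀ d) (K₂ d z) := by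
  rw [disjoint_left]
  rintro _ ⟨a, b, h, rfl⟩ ⟨a', b', h', he⟩
  exact hz (congrArg (sndCoord d) he).symm

/-- The translation that, after the rotation by a right angle, takes `K₁` to `K₂`. -/
noncomputable def linkShift (z : EuclideanSpace ℝ (Fin (d - 1))) : Space d :=
  point 0 0 z - rotation (Real.pi / 2) (point 0 1 0)

theorem rigid_image_K₁ (z : EuclideanSpace ℝ (Fin (d - 1))) :
    rigid (rotation (Real.pi / 2)) (linkShift z) '' K₁ d = K₂ d z := by
  have key : ∀ y : Space d, sndCoord d (rotation (Real.pi / 2) y) = fstCoord d y := fun y => by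
    simp [sndCoord_rotation]
  rw [K₁_eq_roundSphere, K₂_eq_roundSphere]
  have hsub : ∀ x : Space d, rigid (rotation (Real.pi / 2)) (linkShift z) x - point 0 0 z =
      rotation (Real.pi / 2) (x - point 0 1 0) := fun x => by
    rw [rigid, linkShift, map_sub]; abel
  have hiff : ∀ x : Space d, rigid (rotation (Real.pi / 2)) (linkShift z) x ∈
      roundSphere (point 0 0 z) (sndCoord d).toLinearMap.ker ↔
      x ∈ roundSphere (point 0 1 0) (fstCoord d).toLinearMap.ker := fun x => by
    simp only [roundSphere, mem_ofPred_eq, LinearMap.mem_ker, ContinuousLinearMap.coe_coe, hsub,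
      key, LinearIsometryEquiv.norm_map]
  ext q
  constructor
  · rintro ⟨x, hx, rfl⟩
    exact (hiff x).2 hx
  · intro hq
    refine ⟨_, (hiff _).1 ?_, rigid_rigid_symm _ _ q⟩
    rwa [rigid_rigid_symm]

/-- The motion of `T^*ℝ^(2d-1)` that rotates the base about the centre of `K₁`, moves this centre
to `(0, b, c z)`, and pushes and rotates the fibres. -/
noncomputable def motion (z : EuclideanSpace ℝ (Fin (d - 1))) (b c θ ψ β : ℝ)
    (x : Space d × Space d) : Space d × Space d :=
  (b • point 0 1 0 + c • point 0 0 z + rotation θ (x.1 - point 0 1 0),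
    rotation ψ (push (β • ‖z‖⁻¹ • point 0 0 z) x.2))

theorem norm_smul_unit (hz : z ≠ 0) (β : ℝ) :
    ‖β • ‖z‖⁻¹ • (point 0 0 z : Space d)‖ = |β| := by
  rw [norm_smul, norm_smul, norm_point_snd, norm_inv, norm_norm,
    inv_mul_cancel₀ (norm_ne_zero_iff.2 hz), mul_one, Real.norm_eq_abs]

theorem motion_mem_unitCotangent (hz : z ≠ 0) {b c θ ψ β : ℝ} (hβ : |β| < 1)
    {x : Space d × Space d} (hx : x ∈ unitCotangent (Space d)) :
    motion z b c θ ψ β x ∈ unitCotangent (Space d) := by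
  change ‖rotation ψ _‖ = 1
  rw [LinearIsometryEquiv.norm_map]
  exact norm_push (by rwa [norm_smul_unit hz]) hx

theorem isSmoothEmbeddingOn_motion (hz : z ≠ 0) {b c θ ψ β : ℝ} (hβ : |β| < 1) :
    IsSmoothEmbeddingOn (motion z b c θ ψ β) (unitCotangent (Space d)) := by
  have hw : ‖β • ‖z‖⁻¹ • (point 0 0 z : Space d)‖ < 1 := by rwa [norm_smul_unit hz]
  refine ⟨?_, fun y => (point 0 1 0 + (rotation θ).symm
    (y.1 - (b • point 0 1 0 + c • point 0 0 z)),
    unpush (β • ‖z‖⁻¹ • point 0 0 z) ((rotation ψ).symm y.2)), ?_, fun x hx => ?_⟩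
  · have h1 : ContDiff ℝ ∞ fun x : Space d × Space d =>
        x.2 + β • ‖z‖⁻¹ • (point 0 0 z : Space d) := contDiff_snd.add contDiff_const
    have h2 : ContDiffOn ℝ ∞ (fun x : Space d × Space d =>
        push (β • ‖z‖⁻¹ • (point 0 0 z : Space d)) x.2) (unitCotangent (Space d)) :=
      ((h1.contDiffOn.norm ℝ fun x hx => sum_ne_zero_of_norm_lt hw hx).inv fun x hx =>
        norm_ne_zero_iff.2 (sum_ne_zero_of_norm_lt hw hx)).smul h1.contDiffOn
    exact (contDiff_const.add ((rotation θ).contDiff.comp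
      (contDiff_fst.sub contDiff_const))).contDiffOn.prodMk
        ((rotation ψ).contDiff.comp_contDiffOn h2)
  · exact ((contDiff_const.add ((rotation θ).symm.contDiff.comp
      (contDiff_fst.sub contDiff_const))).prodMk
        ((contDiff_unpush hw).comp ((rotation ψ).symm.contDiff.comp contDiff_snd))).contDiffOn
  · refine Prod.ext ?_ ?_
    · simp only [motion]
      rw [add_sub_cancel_left, LinearIsometryEquiv.symm_apply_apply, add_sub_cancel]
    · simp only [motion, LinearIsometryEquiv.symm_apply_apply]
      exact unpush_push hw hx

/-- Where the sphere meets the `z₁`-axis, its tangent space is the whole `z₂`-factor, and a conormal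
covector can be tested against its own `z₂`-component. -/
theorem eq_zero_of_mem_conormal_K₁ {x : Space d × Space d} (hx : x ∈ conormal (K₁ d))
    (h : sndCoord d (x.1 - point 0 1 0) = 0) : sndCoord d x.2 = 0 := by
  have hq := hx.1
  rw [K₁_eq_roundSphere] at hx hq
  have h1 := hx.2 (point 0 0 (sndCoord d x.2)) ((mem_tangentSpace_roundSphere hq).2
    ⟨by simp, by rw [inner_space, h]; simp⟩)
  rw [inner_space] at h1
  simpa using h1

theorem eq_zero_of_mem_conormal_K₀ {x : Space d × Space d} (hx : x ∈ conormal (K₀ d))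
    (h : fstCoord d x.1 = 0) : fstCoord d x.2 = 0 := by
  have hq := hx.1
  rw [K₀_eq_roundSphere] at hx hq
  have h1 := hx.2 (point (fstCoord d x.2) 0 0) ((mem_tangentSpace_roundSphere hq).2
    ⟨by simp, by rw [inner_space, sub_zero, h]; simp⟩)
  rw [inner_space] at h1
  simpa using h1

/-- The alternatives of `hcases` are: the base is still `K₁`; it is a translate of `K₁` along the
`z₁`-axis with pushed and rotated fibres; it lies in `z₁ ≥ 2`; it lies in `z₂ = z`. Only in the
second can the bases meet, and there the `p₀`-component separates the covectors. -/
theorem motion_notMem_unitConormal_K₀ (hz : z ≠ 0) {b c θ ψ β : ℝ} (hβ : |β| < 1)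
    (hcases : (b = 1 ∧ c = 0 ∧ θ = 0) ∨ (c = 0 ∧ θ = 0 ∧ ψ = Real.pi / 2 ∧ β ≠ 0) ∨ b = 3 ∨
      (c = 1 ∧ θ = Real.pi / 2)) {x : Space d × Space d} (hx : x ∈ unitConormal (K₁ d)) :
    motion z b c θ ψ β x ∉ unitConormal (K₀ d) := by
  intro hy
  have hq : x.1 ∈ K₁ d := hx.1.1
  have hq' : (motion z b c θ ψ β x).1 ∈ K₀ d := hy.1.1
  rw [K₁_eq_roundSphere] at hq
  rw [K₀_eq_roundSphere] at hq'
  set v := x.1 - point 0 1 0 with hv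
  have hv0 : fstCoord d v = 0 := hq.1
  have hvn : midCoord d v ^ 2 + ‖sndCoord d v‖ ^ 2 = 1 := by
    have h1 := norm_sq_space v
    rw [hv0, hq.2] at h1
    simpa using h1.symm
  have f0 : fstCoord d (motion z b c θ ψ β x).1 = -Real.sin θ • sndCoord d v := by
    simp [motion, ← hv, fstCoord_rotation, hv0]
  have f1 : midCoord d (motion z b c θ ψ β x).1 = b + midCoord d v := by
    simp [motion, ← hv, midCoord_rotation]
  have f2 : sndCoord d (motion z b c θ ψ β x).1 = c • z + Real.cos θ • sndCoord d v := by
    simp [motion, ← hv, sndCoord_rotation, hv0]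
  have g2 : sndCoord d (motion z b c θ ψ β x).1 = 0 := by simpa using hq'.1
  have gn : ‖fstCoord d (motion z b c θ ψ β x).1‖ ^ 2 +
      midCoord d (motion z b c θ ψ β x).1 ^ 2 = 1 := by
    have h1 := norm_sq_space ((motion z b c θ ψ β x).1 - 0)
    rw [hq'.2, sub_zero, g2] at h1
    simpa using h1.symm
  rw [g2] at f2
  rw [f0, f1] at gn
  rcases hcases with ⟨rfl, rfl, rfl⟩ | ⟨rfl, rfl, rfl, hβ0⟩ | rfl | ⟨rfl, rfl⟩
  · have h1 : sndCoord d v = 0 := by simpa using f2.symm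
    rw [h1, norm_zero] at hvn
    simp only [h1, smul_zero, norm_zero] at gn
    nlinarith
  -- At a common base point both conormal conditions apply: before the motion `p₂ = 0`, after it `p₀
  -- = 0`. But the push followed by the quarter turn gives `p₀` a nonzero multiple of `β • z`.
  · have h1 : sndCoord d v = 0 := by simpa using f2.symm
    have h2 := eq_zero_of_mem_conormal_K₁ hx.1 h1
    have h3 := eq_zero_of_mem_conormal_K₀ hy.1 (by rw [f0, h1, smul_zero])
    have hN : ‖x.2 + β • ‖z‖⁻¹ • (point 0 0 z : Space d)‖ ≠ 0 :=
      norm_ne_zero_iff.2 (sum_ne_zero_of_norm_lt (by rwa [norm_smul_unit hz]) hx.2)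
    simp only [motion, fstCoord_rotation, push, map_smul, map_add, h2, sndCoord_point,
      Real.cos_pi_div_two, Real.sin_pi_div_two, zero_smul, one_smul, zero_sub, smul_eq_zero,
      inv_eq_zero, hN, false_or, neg_zero, zero_add, smul_neg, neg_eq_zero, norm_eq_zero, hβ0, hz]
      at h3
  · have h1 : -1 ≤ midCoord d v := by nlinarith [sq_nonneg ‖sndCoord d v‖]
    nlinarith [sq_nonneg ‖-Real.sin θ • sndCoord d v‖]
  · exact hz (by simpa using f2.symm)

/-- The isotopy that unlinks the unit conormal bundle of `K₁` from that of `K₀`. -/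
noncomputable def unlink (z : EuclideanSpace ℝ (Fin (d - 1))) (s : ℝ) :
    Space d × Space d → Space d × Space d :=
  motion z
    -- Each transition runs over one quarter of the time. In the first, `ψ` reaches a right angle
    -- and the push reaches `1 / 2`, a value in `(0, 1)`; in the second, `b` goes from `1` to `3`;
    -- in the third, `c` and `θ` reach their final values and the push is undone; in the fourth, `b`
    -- goes from `3` to `0`.
    (1 + 2 * Real.smoothTransition (4 * s - 1) - 3 * Real.smoothTransition (4 * s - 3))
    (Real.smoothTransition (4 * s - 2))
    (Real.pi / 2 * Real.smoothTransition (4 * s - 2))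
    (Real.pi / 2 * Real.smoothTransition (4 * s))
    ((Real.smoothTransition (4 * s) - Real.smoothTransition (4 * s - 2)) / 2)

theorem abs_push_coefficient_lt (s : ℝ) :
    |(Real.smoothTransition (4 * s) - Real.smoothTransition (4 * s - 2)) / 2| < 1 := by
  have h1 := Real.smoothTransition.nonneg (4 * s)
  have h2 := Real.smoothTransition.le_one (4 * s)
  have h3 := Real.smoothTransition.nonneg (4 * s - 2)
  have h4 := Real.smoothTransition.le_one (4 * s - 2)
  rw [abs_lt]
  constructor <;> linarith

theorem unlink_notMem_unitConormal_K₀ (hz : z ≠ 0) (s : ℝ) {x : Space d × Space d}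
    (hx : x ∈ unitConormal (K₁ d)) : unlink z s x ∉ unitConormal (K₀ d) := by
  refine motion_notMem_unitConormal_K₀ hz (abs_push_coefficient_lt s) ?_ hx
  rcases le_total s (1 / 4) with h1 | h1
  · left
    rw [Real.smoothTransition.zero_of_nonpos (x := 4 * s - 1) (by linarith),
      Real.smoothTransition.zero_of_nonpos (x := 4 * s - 2) (by linarith),
      Real.smoothTransition.zero_of_nonpos (x := 4 * s - 3) (by linarith)]
    norm_num
  right
  have e0 := Real.smoothTransition.one_of_one_le (x := 4 * s) (by linarith)
  rcases le_total s (1 / 2) with h2 | h2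
  · left
    rw [e0, Real.smoothTransition.zero_of_nonpos (x := 4 * s - 2) (by linarith)]
    norm_num
  right
  have e1 := Real.smoothTransition.one_of_one_le (x := 4 * s - 1) (by linarith)
  rcases le_total s (3 / 4) with h3 | h3
  · left
    rw [e1, Real.smoothTransition.zero_of_nonpos (x := 4 * s - 3) (by linarith)]
    norm_num
  right
  rw [Real.smoothTransition.one_of_one_le (x := 4 * s - 2) (by linarith)]
  norm_num

theorem unlink_zero {x : Space d × Space d} (hx : x ∈ unitCotangent (Space d)) :
    unlink z 0 x = x := by
  have h : ∀ y : ℝ, y ≤ 0 → Real.smoothTransition y = 0 := fun _ =>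
    Real.smoothTransition.zero_of_nonpos
  rw [unlink, h (4 * 0 - 1) (by norm_num), h (4 * 0) (by norm_num),
    h (4 * 0 - 2) (by norm_num), h (4 * 0 - 3) (by norm_num)]
  simp only [motion, mul_zero, add_zero, sub_zero, zero_div, zero_smul, one_smul, rotation_zero,
    push_zero hx, add_sub_cancel]

theorem unlink_one {x : Space d × Space d} (hx : x ∈ unitCotangent (Space d)) :
    unlink z 1 x = cotangentRigid (rotation (Real.pi / 2)) (linkShift z) x := by
  have h : ∀ y : ℝ, 1 ≤ y → Real.smoothTransition y = 1 := fun _ =>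
    Real.smoothTransition.one_of_one_le
  have h3 : (1 : ℝ) + 2 * 1 - 3 * 1 = 0 := by norm_num
  rw [unlink, h (4 * 1 - 1) (by norm_num), h (4 * 1) (by norm_num),
    h (4 * 1 - 2) (by norm_num), h (4 * 1 - 3) (by norm_num), h3]
  simp only [motion, mul_one, sub_self, zero_div, zero_smul, one_smul, push_zero hx,
    cotangentRigid, linkShift, map_sub, zero_add]
  refine Prod.ext ?_ rfl
  simp only
  abel

theorem contDiffOn_motion (hz : z ≠ 0) {b c θ ψ β : ℝ → ℝ} (hb : ContDiff ℝ ∞ b)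
    (hc : ContDiff ℝ ∞ c) (hθ : ContDiff ℝ ∞ θ) (hψ : ContDiff ℝ ∞ ψ) (hβ : ContDiff ℝ ∞ β)
    (hβ1 : ∀ s, |β s| < 1) :
    ContDiffOn ℝ ∞ (fun y : ℝ × (Space d × Space d) =>
      motion z (b y.1) (c y.1) (θ y.1) (ψ y.1) (β y.1) y.2)
      (univ ×ˢ unitCotangent (Space d)) := by
  have hrot : ∀ {θ : ℝ → ℝ} {f : ℝ × (Space d × Space d) → Space d}
      {S : Set (ℝ × (Space d × Space d))}, ContDiff ℝ ∞ θ → ContDiffOn ℝ ∞ f S →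
      ContDiffOn ℝ ∞ (fun y => rotation (θ y.1) (f y)) S := by
    intro θ f S hθ hf
    have h1 : ContDiffOn ℝ ∞ (fun y : ℝ × (Space d × Space d) => θ y.1) S :=
      (hθ.comp contDiff_fst).contDiffOn
    have h2 := (contDiff_rotation (d := d)).comp_contDiffOn (h1.prodMk hf)
    simpa only [Function.comp_def] using h2
  have hfst : ContDiff ℝ ∞ fun y : ℝ × (Space d × Space d) => y.1 := contDiff_fst
  have hsmul : ∀ {f : ℝ → ℝ} (w : Space d), ContDiff ℝ ∞ f →
      ContDiff ℝ ∞ fun y : ℝ × (Space d × Space d) => f y.1 • w := fun w hf =>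
    (hf.comp hfst).smul contDiff_const
  have h1 : ContDiff ℝ ∞ fun y : ℝ × (Space d × Space d) =>
      y.2.2 + β y.1 • ‖z‖⁻¹ • (point 0 0 z : Space d) :=
    contDiff_snd.snd.add (hsmul _ hβ)
  have hne : ∀ y ∈ univ ×ˢ unitCotangent (Space d),
      y.2.2 + β y.1 • ‖z‖⁻¹ • (point 0 0 z : Space d) ≠ 0 := fun y hy =>
    sum_ne_zero_of_norm_lt (by rw [norm_smul_unit hz]; exact hβ1 y.1) hy.2
  have h2 : ContDiffOn ℝ ∞ (fun y : ℝ × (Space d × Space d) =>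
      push (β y.1 • ‖z‖⁻¹ • (point 0 0 z : Space d)) y.2.2)
      (univ ×ˢ unitCotangent (Space d)) :=
    ((h1.contDiffOn.norm ℝ hne).inv fun y hy => norm_ne_zero_iff.2 (hne y hy)).smul
      h1.contDiffOn
  have h3 : ContDiff ℝ ∞ fun y : ℝ × (Space d × Space d) =>
      b y.1 • (point 0 1 0 : Space d) + c y.1 • point 0 0 z :=
    (hsmul _ hb).add (hsmul _ hc)
  have h4 : ContDiff ℝ ∞ fun y : ℝ × (Space d × Space d) => y.2.1 - point 0 1 0 :=
    contDiff_snd.fst.sub contDiff_const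
  exact (h3.contDiffOn.add (hrot hθ h4.contDiffOn)).prodMk (hrot hψ h2)

theorem contDiffOn_unlink (hz : z ≠ 0) : ContDiffOn ℝ ∞ (Function.uncurry (unlink z))
    (univ ×ˢ unitCotangent (Space d)) := by
  have ht : ∀ a : ℝ, ContDiff ℝ ∞ fun s => Real.smoothTransition (4 * s - a) := fun a =>
    Real.smoothTransition.contDiff.comp ((contDiff_const.mul contDiff_id).sub contDiff_const)
  have ht0 : ContDiff ℝ ∞ fun s => Real.smoothTransition (4 * s) :=
    Real.smoothTransition.contDiff.comp (contDiff_const.mul contDiff_id)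
  have hb : ContDiff ℝ ∞ fun s : ℝ => 1 + 2 * Real.smoothTransition (4 * s - 1) -
      3 * Real.smoothTransition (4 * s - 3) :=
    (contDiff_const.add (contDiff_const.mul (ht 1))).sub (contDiff_const.mul (ht 3))
  have hθ : ContDiff ℝ ∞ fun s : ℝ => Real.pi / 2 * Real.smoothTransition (4 * s - 2) :=
    contDiff_const.mul (ht 2)
  have hψ : ContDiff ℝ ∞ fun s : ℝ => Real.pi / 2 * Real.smoothTransition (4 * s) :=
    contDiff_const.mul ht0
  have hβ : ContDiff ℝ ∞ fun s : ℝ =>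
      (Real.smoothTransition (4 * s) - Real.smoothTransition (4 * s - 2)) / 2 :=
    (ht0.sub (ht 2)).div_const 2
  refine (contDiffOn_motion hz hb (ht 2) hθ hψ hβ abs_push_coefficient_lt).congr fun y _ => ?_
  simp only [Function.uncurry_def, unlink]

/-- The final rigid motion is joined to the identity by rotating about the centre of `K₁` while this
centre moves along a segment to `(0, 0, z)`. Crossing `K₀` is harmless here, as the path only serves
to lift the motion. -/
theorem exists_linkRotation_lift {k : ℕ} {σ : FrameCover.{u} (Space d) (k + 1)}
    (hσ : IsSpinStructure (univ : Set (Space d)) σ) (z : EuclideanSpace ℝ (Fin (d - 1))) :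
    ∃ Θ : σ.carrier ≃ₜ σ.carrier, ∀ y, σ.proj (Θ y) =
      (rigid (rotation (Real.pi / 2)) (linkShift z) (σ.proj y).1,
        fun i => rotation (Real.pi / 2) ((σ.proj y).2 i)) := by
  have hr : Continuous fun x : ℝ × Space d => rotation x.1 x.2 := contDiff_rotation.continuous
  have h := hσ.exists_rigid_lift (fun s => rotation (Real.pi / 2 * s))
    (fun s => s • point 0 0 z + (1 - s) • point 0 1 0 -
      rotation (Real.pi / 2 * s) (point 0 1 0))
    (hr.comp (f := fun x : ℝ × Space d => (Real.pi / 2 * x.1, x.2)) (by fun_prop))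
    (by
      simp only [rotation_symm]
      exact hr.comp (f := fun x : ℝ × Space d => (-(Real.pi / 2 * x.1), x.2)) (by fun_prop))
    (by
      refine Continuous.sub (by fun_prop) ?_
      exact hr.comp (f := fun s : ℝ => (Real.pi / 2 * s, (point 0 1 0 : Space d))) (by fun_prop))
    (fun v => by rw [mul_zero, rotation_zero]) (by simp [rotation_zero])
  simpa [linkShift] using h

theorem spinIsotopic_link {k : ℕ} (hz : z ≠ 0) {σ : FrameCover.{u} (Space d) (k + 1)}
    (hσ : IsSpinStructure (univ : Set (Space d)) σ) :
    SpinIsotopic (unitCotangent (Space d))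
      (unitConormal (K₀ d ∪ K₁ d)) (unitConormal (K₀ d ∪ K₂ d z))
      (unitConormalCover σ (K₀ d ∪ K₁ d)) (unitConormalCover σ (K₀ d ∪ K₂ d z)) := by
  obtain ⟨Θ, hΘ⟩ := exists_linkRotation_lift hσ z
  have hsub : unitConormal (K₁ d) ⊆ unitCotangent (Space d) := inter_subset_right
  have hd' := disjoint_K₀_K₂ hz
  rw [← rigid_image_K₁] at hd' ⊢
  refine spinIsotopic_of_motion ?_ ?_ (disjoint_K₀_K₁ d) hd' ?_ ?_ Θ hΘ (unlink z) ?_ ?_ ?_ ?_ ?_ ?_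
  · rw [K₀_eq_roundSphere]; exact isClosed_roundSphere _ _
  · rw [K₁_eq_roundSphere]; exact isClosed_roundSphere _ _
  · rw [K₀_eq_roundSphere]; exact isCompact_unitConormal_roundSphere _ _
  · rw [K₁_eq_roundSphere]; exact isCompact_unitConormal_roundSphere _ _
  · exact (contDiffOn_unlink hz).mono (prod_mono (subset_univ _) hsub)
  · exact fun s _ => (isSmoothEmbeddingOn_motion hz (abs_push_coefficient_lt s)).mono hsub
  · exact fun s _ x hx => motion_mem_unitCotangent hz (abs_push_coefficient_lt s) (hsub hx)
  · exact fun s _ x hx => unlink_notMem_unitConormal_K₀ hz s hx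
  · exact fun x hx => unlink_zero (hsub hx)
  · exact fun x hx => unlink_one (hsub hx)

theorem isSphereUnion_K₀_K₁ (d : ℕ) : IsSphereUnion (d - 1 + 1) (K₀ d ∪ K₁ d) := by
  have h := disjoint_K₀_K₁ d
  rw [K₀_eq_roundSphere, K₁_eq_roundSphere] at h ⊢
  exact isSphereUnion_union finrank_ker_sndCoord finrank_ker_fstCoord (isClosed_roundSphere _ _)
    (isClosed_roundSphere _ _) h

theorem isSphereUnion_K₀_K₂ (hz : z ≠ 0) : IsSphereUnion (d - 1 + 1) (K₀ d ∪ K₂ d z) := by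
  have h := disjoint_K₀_K₂ hz
  rw [K₀_eq_roundSphere, K₂_eq_roundSphere] at h ⊢
  exact isSphereUnion_union finrank_ker_sndCoord finrank_ker_sndCoord (isClosed_roundSphere _ _)
    (isClosed_roundSphere _ _) h

end Link

end ConormalSpin

theorem mainTheorem6 (d : ℕ) (hd : 2 ≤ d) (z : EuclideanSpace ℝ (Fin (d - 1))) (hz : z ≠ 0)
    (σ : FrameCover.{u} (Space d) (2 * d - 2 + 1))
    (hσ : IsSpinStructure (Set.univ : Set (Space d)) σ) :
    IsSmoothSubmanifold (2 * d - 2) (unitConormal (K₀ d ∪ K₁ d)) ∧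
    IsSmoothSubmanifold (2 * d - 2) (unitConormal (K₀ d ∪ K₂ d z)) ∧
    IsSpinStructure (unitConormal (K₀ d ∪ K₁ d)) (unitConormalCover σ (K₀ d ∪ K₁ d)) ∧
    IsSpinStructure (unitConormal (K₀ d ∪ K₂ d z)) (unitConormalCover σ (K₀ d ∪ K₂ d z)) ∧
    SpinIsotopic (unitCotangent (Space d))
      (unitConormal (K₀ d ∪ K₁ d)) (unitConormal (K₀ d ∪ K₂ d z))
      (unitConormalCover σ (K₀ d ∪ K₁ d)) (unitConormalCover σ (K₀ d ∪ K₂ d z)) := by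
  have hdim : 2 * d - 2 = d - 1 + (d - 1) := by omega
  have hV : Module.finrank ℝ (Space d) = 2 * d - 2 + 1 := by rw [finrank_space, hdim]
  refine ⟨?_, ?_, (isSphereUnion_K₀_K₁ d).isSpinStructure_unitConormalCover hV hσ,
    (isSphereUnion_K₀_K₂ hz).isSpinStructure_unitConormalCover hV hσ, spinIsotopic_link hz hσ⟩
  · rw [hdim]
    exact (isSphereUnion_K₀_K₁ d).isSmoothSubmanifold_unitConormal finrank_space
  · rw [hdim]
    exact (isSphereUnion_K₀_K₂ hz).isSmoothSubmanifold_unitConormal finrank_space
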